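/- **Logic.** A discounting function is a strictly decreasing $\eta:\mathbb N\to[0,1]$ with $\lim_i\eta(i)=0$; put $\eta^{+1}(i)=\eta(i+1)$. Let $\mathcal D$ be a set of discounting functions and $AP$ a set of atomic propositions. The formulas of $\mathrm{LTL}^{\mathrm{disc}}[\mathcal D]$ are $$\varphi ::= \mathtt{True}\mid p\mid \neg\varphi\mid \varphi\vee\varphi\mid \mathsf X\varphi\mid \varphi\,\mathsf U\,\varphi\mid \varphi\,\mathsf U_\eta\,\varphi\qquad(p\in AP,\ \eta\in\mathcal D).$$ A computation is a word $\pi=\pi_0\pi_1\cdots\in(2^{AP})^\omega$, and $\pi^i=\pi_i\pi_{i+1}\cdots$. The value $[[\pi,\varphi]]\in[0,1]$ is: $[[\pi,\mathtt{True}]]=1$; $[[\pi,p]]=1$ if $p\in\pi_0$ and $0$ otherwise; $[[\pi,\neg\varphi]]=1-[[\pi,\varphi]]$; $[[\pi,\varphi\vee\psi]]=\max\{[[\pi,\varphi]],[[\pi,\psi]]\}$; $[[\pi,\mathsf X\varphi]]=[[\pi^1,\varphi]]$; $$[[\pi,\varphi\,\mathsf U_\eta\,\psi]]=\sup_{i\ge0}\min\Bigl\{\eta(i)[[\pi^i,\psi]],\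 \min_{0\le j<i}\eta(j)[[\pi^j,\varphi]]\Bigr\},$$ and $[[\pi,\varphi\,\mathsf U\,\psi]]$ is given by the same expression without the factors $\eta(i),\eta(j)$. LTL formulas are those without operators $\mathsf U_\eta$. **The LTL formulas $\varphi^+$ and $\varphi^{<1}$.** By recursion: $\mathtt{True}^+=\mathtt{True}$, $p^+=p$, $(\neg\varphi)^+=\varphi^{<1}$, $(\varphi\vee\psi)^+=\varphi^+\vee\psi^+$, $(\mathsf X\varphi)^+=\mathsf X\varphi^+$, $(\varphi\,\mathsf U\,\psi)^+=(\varphi\,\mathsf U_\eta\,\psi)^+=\varphi^+\,\mathsf U\,\psi^+$; and $\mathtt{True}^{<1}=\neg\mathtt{True}$, $p^{<1}=\neg p$, $(\neg\varphi)^{<1}=\varphi^+$, $(\varphi\vee\psi)^{<1}=\varphi^{<1}\wedge\psi^{<1}$ (where $a\wedge b=\neg(\neg a\vee\neg b)$), $(\mathsf X\varphi)^{<1}=\mathsf X\varphi^{<1}$, $(\varphi\,\mathsf U\,\psi)^{<1}=\neg\bigl((\neg\varphi^{<1})\,\mathsf U\,(\neg\psi^{<1})\bigr)$, $(\varphi\,\mathsf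 U_\eta\,\psi)^{<1}=\mathtt{True}$ if $\eta(0)<1$, and $\psi^{<1}$ if $\eta(0)=1$. **Automata.** $\mathcal B^+(Q)$ is the set of positive Boolean formulas over $Q$ (built from $\mathtt{True},\mathtt{False}$, elements of $Q$, $\wedge$, $\vee$). An alternating Büchi automaton consists of an alphabet $\Sigma$, a finite set $Q$ of states, an initial state $q_{in}$, a function $\delta:Q\times\Sigma\to\mathcal B^+(Q)$ and a set $\alpha\subseteq Q$. A run on $\sigma_0\sigma_1\cdots\in\Sigma^\omega$ is a dag with nodes $V\subseteq Q\times\mathbb N$ and edges leading from level $l$ to level $l+1$, such that the only node of level $0$ is $\langle q_{in},0\rangle$, for every node $\langle q,l\rangle$ the set of states of its successors satisfies $\delta(q,\sigma_l)$, and every node of a level $l+1$ is the target of an edge. The run is accepting if every infinite path of it visits $\alpha$ infinitely often; $L(\mathcal A)$ is the set of words that have an accepting run. The automaton is weak (an AWA) if $Q$ has a partition into sets $Q_1,\dots,Q_k$, each contained in $\alpha$ or disjoint from $\alpha$, and there is a partial order on these sets such that $Q_j\le Q_i$ whenever some $s\in Q_j$ occurs in $\delta(q,\sigma)$ for some $q\in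 Q_i$, $\sigma\in\Sigma$. **The automaton $\mathcal A_{\varphi,v}$.** Let $\varphi$ be an $\mathrm{LTL}^{\mathrm{disc}}[\mathcal D]$ formula and $v\in[0,1]$. States are assertions $(\psi>t)$, $(\psi<t)$ with $t\in[0,1]$, and LTL formulas. The alphabet is $2^{AP}$. For an LTL formula as a state: $\delta(\mathtt{True},\sigma)=\mathtt{True}$; $\delta(p,\sigma)=\mathtt{True}$ if $p\in\sigma$, else $\mathtt{False}$; $\delta(\zeta_1\vee\zeta_2,\sigma)=\delta(\zeta_1,\sigma)\vee\delta(\zeta_2,\sigma)$; $\delta(\neg\zeta,\sigma)=\overline{\delta(\zeta,\sigma)}$; $\delta(\mathsf X\zeta,\sigma)=\zeta$; $\delta(\zeta_1\mathsf U\zeta_2,\sigma)=\delta(\zeta_2,\sigma)\vee(\delta(\zeta_1,\sigma)\wedge\zeta_1\mathsf U\zeta_2)$, where $\overline\theta$ exchanges $\mathtt{True}$ with $\mathtt{False}$ and $\wedge$ with $\vee$, and replaces each state $\psi$ by $\neg\psi$ ($\neg\neg\psi$ being identified with $\psi$). For assertions: - $\delta((\mathtt{True}>t),\sigma)=\mathtt{True}$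 if $t<1$, else $\mathtt{False}$; $\delta((\mathtt{True}<t),\sigma)=\mathtt{False}$. - $\delta((p>t),\sigma)=\mathtt{True}$ if $p\in\sigma$ and $t<1$, else $\mathtt{False}$; $\delta((p<t),\sigma)=\mathtt{False}$ if $p\in\sigma$ or $t=0$, else $\mathtt{True}$. - $\delta((\psi_1\vee\psi_2>t),\sigma)=\delta((\psi_1>t),\sigma)\vee\delta((\psi_2>t),\sigma)$; $\delta((\psi_1\vee\psi_2<t),\sigma)=\delta((\psi_1<t),\sigma)\wedge\delta((\psi_2<t),\sigma)$. - $\delta((\neg\psi>t),\sigma)=\delta((\psi<1-t),\sigma)$; $\delta((\neg\psi<t),\sigma)=\delta((\psi>1-t),\sigma)$. - $\delta((\mathsf X\psi>t),\sigma)=(\psi>t)$; $\delta((\mathsf X\psi<t),\sigma)=(\psi<t)$. - With $r=t/\eta(0)$, $\delta((\psi_1\mathsf U_\eta\psi_2>t),\sigma)$ is $\delta((\psi_2>r),\sigma)\vee[\delta((\psi_1>r),\sigma)\wedge(\psi_1\mathsf U_{\eta^{+1}}\psi_2>t)]$ if $0<r<1$, $\mathtt{False}$ if $r\ge1$, and $\delta((\psi_1\mathsf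 U_\eta\psi_2)^+,\sigma)$ if $r=0$. - With $r=t/\eta(0)$, $\delta((\psi_1\mathsf U_\eta\psi_2<t),\sigma)$ is $\delta((\psi_2<r),\sigma)\wedge[\delta((\psi_1<r),\sigma)\vee(\psi_1\mathsf U_{\eta^{+1}}\psi_2<t)]$ if $0<r\le1$, $\mathtt{True}$ if $r>1$, and $\mathtt{False}$ if $r=0$. - $\delta((\psi_1\mathsf U\psi_2>t),\sigma)$ and $\delta((\psi_1\mathsf U\psi_2<t),\sigma)$ are given by the last two rules with $r=t$ and with $\mathsf U$ in place of $\mathsf U_\eta$ and $\mathsf U_{\eta^{+1}}$. The initial state is $(\varphi>v)$, and the state space of $\mathcal A_{\varphi,v}$ is the set of the states reachable from it, i.e. the least set that contains it and, with each $q$, all states that occur in $\delta(q,\sigma)$ for some $\sigma\in2^{AP}$. The accepting states are those of the form $(\psi_1\mathsf U\psi_2<t)$ and the LTL formulas of the form $\neg(\psi_1\mathsf U\psi_2)$. **Corollary.** For every set $\mathcal D$ of discounting functions, every $\mathrm{LTL}^{\mathrm{disc}}[\mathcal D]$ formula $\varphi$ and every threshold $v\in[0,1]$, $\mathcal A_{\varphi,v}$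 is an alternating weak automaton (in particular, it has finitely many states), and $$L(\mathcal A_{\varphi,v})\ne\emptyset\iff\text{there is a computation }\pi\text{ with }[[\pi,\varphi]]>v.$$ -/

import Mathlib

/-! ## Discounting functions -/

/-- A discounting function: a strictly decreasing `η : ℕ → [0,1]` that tends to `0`. -/
structure DiscountFun where
  toFun : ℕ → ℝ
  mem_Icc : ∀ i, toFun i ∈ Set.Icc (0 : ℝ) 1
  strictAnti : StrictAnti toFun
  tendsto_zero : Filter.Tendsto toFun Filter.atTop (nhds 0)

instance : CoeFun DiscountFun (fun _ => ℕ → ℝ) := ⟨DiscountFun.toFun⟩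

/-- The shifted function `η^{+k}`, `η^{+k}(i) = η(i + k)`. -/
def DiscountFun.shift (η : DiscountFun) (k : ℕ) : DiscountFun where
  toFun i := η (i + k)
  mem_Icc i := η.mem_Icc (i + k)
  strictAnti _ _ h := η.strictAnti (Nat.add_lt_add_right h k)
  tendsto_zero := η.tendsto_zero.comp (Filter.tendsto_add_atTop_nat k)

/-! ## Discounted LTL -/

/-- Formulas of discounted LTL, with an operator `U_η` for every discounting function `η`. -/
inductive DFormula (AP : Type*) where
  | tt : DFormula AP
  | atom (p : AP) : DFormula AP
  | neg (φ : DFormula AP) : DFormula AP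
  | or (φ ψ : DFormula AP) : DFormula AP
  | next (φ : DFormula AP) : DFormula AP
  | til (φ ψ : DFormula AP) : DFormula AP
  | dtil (η : DiscountFun) (φ ψ : DFormula AP) : DFormula AP

/-- `φ` is a formula of the logic over the set `D`: every `U_η` that occurs in `φ` has `η ∈ D`. -/
def DFormula.Over {AP : Type*} (D : Set DiscountFun) : DFormula AP → Prop
  | .tt => True
  | .atom _ => True
  | .neg φ => φ.Over D
  | .or φ ψ => φ.Over D ∧ ψ.Over D
  | .next φ => φ.Over D
  | .til φ ψ => φ.Over D ∧ ψ.Over D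
  | .dtil η φ ψ => η ∈ D ∧ φ.Over D ∧ ψ.Over D

/-- The suffix `w_i, w_{i+1}, …` of an infinite word. -/
def wordSuffix {A : Type*} (w : ℕ → A) (i : ℕ) : ℕ → A := fun n => w (i + n)

open Classical in
/-- The satisfaction value of a formula in a computation `π ∈ (2^AP)^ω`. The term
`(Finset.range i).fold min a b` is `min {a, min_{0 ≤ j < i} b j}`, which is `a` for `i = 0`. -/
noncomputable def DFormula.value {AP : Type*} : DFormula AP → (ℕ → Set AP) → ℝ
  | .tt, _ => 1
  | .atom p, π => if p ∈ π 0 then 1 else 0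
  | .neg φ, π => 1 - φ.value π
  | .or φ ψ, π => max (φ.value π) (ψ.value π)
  | .next φ, π => φ.value (wordSuffix π 1)
  | .til φ ψ, π => ⨆ i : ℕ, (Finset.range i).fold min
      (ψ.value (wordSuffix π i)) (fun j => φ.value (wordSuffix π j))
  | .dtil η φ ψ, π => ⨆ i : ℕ, (Finset.range i).fold min
      (η i * ψ.value (wordSuffix π i)) (fun j => η j * φ.value (wordSuffix π j))

/-! ## Boolean LTL, and the formulas `φ⁺` and `φ^{<1}` -/

/-- Formulas of (Boolean) LTL. -/
inductive LTLFormula (AP : Type*) where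
  | tt : LTLFormula AP
  | atom (p : AP) : LTLFormula AP
  | neg (φ : LTLFormula AP) : LTLFormula AP
  | or (φ ψ : LTLFormula AP) : LTLFormula AP
  | next (φ : LTLFormula AP) : LTLFormula AP
  | til (φ ψ : LTLFormula AP) : LTLFormula AP

/-- Conjunction, as the usual abbreviation. -/
def LTLFormula.and {AP : Type*} (φ ψ : LTLFormula AP) : LTLFormula AP := .neg (.or φ.neg ψ.neg)

/-- The negation of a state of the automaton of an LTL formula; `¬¬ψ` is identified with `ψ`. -/
def LTLFormula.compl {AP : Type*} : LTLFormula AP → LTLFormula AP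
  | .neg φ => φ
  | φ => .neg φ

open Classical in
mutual

/-- The LTL formula `φ⁺` that stands for `⟦π, φ⟧ > 0`. -/
noncomputable def DFormula.pos {AP : Type*} : DFormula AP → LTLFormula AP
  | .tt => .tt
  | .atom p => .atom p
  | .neg φ => φ.ltOne
  | .or φ ψ => .or φ.pos ψ.pos
  | .next φ => .next φ.pos
  | .til φ ψ => .til φ.pos ψ.pos
  | .dtil _ φ ψ => .til φ.pos ψ.pos

/-- The LTL formula `φ^{<1}` that stands for `⟦π, φ⟧ < 1`. -/
noncomputable def DFormula.ltOne {AP : Type*} : DFormula AP → LTLFormula AP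
  | .tt => .neg .tt
  | .atom p => .neg (.atom p)
  | .neg φ => φ.pos
  | .or φ ψ => .and φ.ltOne ψ.ltOne
  | .next φ => .next φ.ltOne
  | .til φ ψ => .neg (.til (.neg φ.ltOne) (.neg ψ.ltOne))
  | .dtil η _ ψ => if η 0 < 1 then .tt else ψ.ltOne

end

/-! ## Positive Boolean formulas and alternating automata -/

/-- The positive Boolean formulas `B⁺(X)`. -/
inductive PosBool (X : Type*) where
  | tt : PosBool X
  | ff : PosBool X
  | atom (x : X) : PosBool X
  | and (θ χ : PosBool X) : PosBool X
  | or (θ χ : PosBool X) : PosBool X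

namespace PosBool

/-- The elements of `X` that occur in the formula. -/
def atoms {X : Type*} : PosBool X → Set X
  | tt => ∅
  | ff => ∅
  | atom x => {x}
  | and θ χ => θ.atoms ∪ χ.atoms
  | or θ χ => θ.atoms ∪ χ.atoms

/-- `Y ⊆ X` satisfies the formula. -/
def Sat {X : Type*} (Y : Set X) : PosBool X → Prop
  | tt => True
  | ff => False
  | atom x => x ∈ Y
  | and θ χ => θ.Sat Y ∧ χ.Sat Y
  | or θ χ => θ.Sat Y ∨ χ.Sat Y

/-- Renaming of the elements of `X`. -/
def map {X Z : Type*} (f : X → Z) : PosBool X → PosBool Z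
  | tt => tt
  | ff => ff
  | atom x => atom (f x)
  | and θ χ => and (θ.map f) (χ.map f)
  | or θ χ => or (θ.map f) (χ.map f)

/-- A formula whose elements all have the property `P`, as a formula over the subtype. -/
def restrict {X : Type*} {P : X → Prop} :
    (θ : PosBool X) → (∀ x ∈ θ.atoms, P x) → PosBool {x // P x}
  | tt, _ => tt
  | ff, _ => ff
  | atom x, h => atom ⟨x, h x rfl⟩
  | and θ χ, h => and (θ.restrict fun x hx => h x (Or.inl hx)) (χ.restrict fun x hx => h x (Or.inr hx))
  | or θ χ, h => or (θ.restrict fun x hx => h x (Or.inl hx)) (χ.restrict fun x hx => h x (Or.inr hx))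

/-- The dual formula, over LTL formulas. -/
def dual {AP : Type*} : PosBool (LTLFormula AP) → PosBool (LTLFormula AP)
  | tt => ff
  | ff => tt
  | atom φ => atom φ.compl
  | and θ χ => or θ.dual χ.dual
  | or θ χ => and θ.dual χ.dual

end PosBool

/-- An alternating Büchi automaton with alphabet `A` and state space `Q`. That `Q` is finite is
required in `IsAWA`. -/
structure AltAutomaton (A Q : Type*) where
  init : Q
  δ : Q → A → PosBool Q
  acc : Set Q

namespace AltAutomaton

variable {A Q : Type*}

/-- A run dag on the word `w`: `V l` is the set of states at level `l`, and `E l q q'` says that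
there is an edge from `(q, l)` to `(q', l + 1)`. -/
structure IsRun (M : AltAutomaton A Q) (w : ℕ → A) (V : ℕ → Set Q) (E : ℕ → Q → Q → Prop) :
    Prop where
  root : V 0 = {M.init}
  edge_mem : ∀ l q q', E l q q' → q ∈ V l ∧ q' ∈ V (l + 1)
  sat : ∀ l, ∀ q ∈ V l, (M.δ q (w l)).Sat {q' | E l q q'}
  -- the levels are minimal: they hold no node that is not the target of an edge
  minimal : ∀ l, ∀ q' ∈ V (l + 1), ∃ q, E l q q'

/-- Every infinite path of the dag, starting at any level, visits `acc` infinitely often. -/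
def AcceptingDag (M : AltAutomaton A Q) (E : ℕ → Q → Q → Prop) : Prop :=
  ∀ (l : ℕ) (ρ : ℕ → Q), (∀ i, E (l + i) (ρ i) (ρ (i + 1))) → ∀ n, ∃ i ≥ n, ρ i ∈ M.acc

def Accepts (M : AltAutomaton A Q) (w : ℕ → A) : Prop :=
  ∃ V E, M.IsRun w V E ∧ M.AcceptingDag E

def language (M : AltAutomaton A Q) : Set (ℕ → A) := {w | M.Accepts w}

/-- Weakness: a partition of the state space into sets `{q | c q = i}`, `i = 1, …, k`, each of them
accepting or rejecting, and a partial order on the sets such that no transition goes up. -/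
def IsWeak (M : AltAutomaton A Q) : Prop :=
  ∃ (k : ℕ) (c : Q → Fin k) (P : PartialOrder (Fin k)),
    Function.Surjective c ∧
    (∀ i, (∀ q, c q = i → q ∈ M.acc) ∨ (∀ q, c q = i → q ∉ M.acc)) ∧
    ∀ q a, ∀ s ∈ (M.δ q a).atoms, P.le (c s) (c q)

/-- An alternating weak automaton (with finitely many states). -/
def IsAWA (M : AltAutomaton A Q) : Prop := Finite Q ∧ M.IsWeak

end AltAutomaton

/-! ## The automaton of a discounted formula and a threshold -/

open Classical in
/-- The transition function of the standard translation of LTL to alternating weak automata. -/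
noncomputable def LTLFormula.trans {AP : Type*} :
    LTLFormula AP → Set AP → PosBool (LTLFormula AP)
  | .tt, _ => .tt
  | .atom p, σ => if p ∈ σ then .tt else .ff
  | .neg φ, σ => (φ.trans σ).dual
  | .or φ ψ, σ => .or (φ.trans σ) (ψ.trans σ)
  | .next φ, _ => .atom φ
  | .til φ ψ, σ => .or (ψ.trans σ) (.and (φ.trans σ) (.atom (.til φ ψ)))

/-- The possible states: assertions `(ψ > t)` and `(ψ < t)`, and LTL formulas. -/
inductive AState (AP : Type*) where
  | gt (ψ : DFormula AP) (t : ℝ) : AState AP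
  | lt (ψ : DFormula AP) (t : ℝ) : AState AP
  | ltl (ψ : LTLFormula AP) : AState AP

open Classical in
mutual

/-- The transitions `δ((ψ > t), σ)`. -/
noncomputable def DFormula.transGt {AP : Type*} :
    DFormula AP → ℝ → Set AP → PosBool (AState AP)
  | .tt, t, _ => if t < 1 then .tt else .ff
  | .atom p, t, σ => if p ∈ σ ∧ t < 1 then .tt else .ff
  | .neg φ, t, σ => φ.transLt (1 - t) σ
  | .or φ ψ, t, σ => .or (φ.transGt t σ) (ψ.transGt t σ)
  | .next φ, t, _ => .atom (.gt φ t)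
  | .til φ ψ, t, σ =>
      if 0 < t ∧ t < 1 then
        .or (ψ.transGt t σ) (.and (φ.transGt t σ) (.atom (.gt (.til φ ψ) t)))
      else if 1 ≤ t then .ff
      else (((DFormula.til φ ψ).pos).trans σ).map .ltl
  | .dtil η φ ψ, t, σ =>
      if 0 < t / η 0 ∧ t / η 0 < 1 then
        .or (ψ.transGt (t / η 0) σ)
          (.and (φ.transGt (t / η 0) σ) (.atom (.gt (.dtil (η.shift 1) φ ψ) t)))
      else if 1 ≤ t / η 0 then .ff
      else (((DFormula.dtil η φ ψ).pos).trans σ).map .ltl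

/-- The transitions `δ((ψ < t), σ)`. -/
noncomputable def DFormula.transLt {AP : Type*} :
    DFormula AP → ℝ → Set AP → PosBool (AState AP)
  | .tt, _, _ => .ff
  | .atom p, t, σ => if p ∈ σ ∨ t = 0 then .ff else .tt
  | .neg φ, t, σ => φ.transGt (1 - t) σ
  | .or φ ψ, t, σ => .and (φ.transLt t σ) (ψ.transLt t σ)
  | .next φ, t, _ => .atom (.lt φ t)
  | .til φ ψ, t, σ =>
      if 0 < t ∧ t ≤ 1 then
        .and (ψ.transLt t σ) (.or (φ.transLt t σ) (.atom (.lt (.til φ ψ) t)))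
      else if 1 < t then .tt
      else .ff
  | .dtil η φ ψ, t, σ =>
      if 0 < t / η 0 ∧ t / η 0 ≤ 1 then
        .and (ψ.transLt (t / η 0) σ)
          (.or (φ.transLt (t / η 0) σ) (.atom (.lt (.dtil (η.shift 1) φ ψ) t)))
      else if 1 < t / η 0 then .tt
      else .ff

end

namespace AState

variable {AP : Type*}

/-- The transition function on all possible states. -/
noncomputable def trans : AState AP → Set AP → PosBool (AState AP)
  | gt ψ t, σ => ψ.transGt t σ
  | lt ψ t, σ => ψ.transLt t σ
  | ltl ψ, σ => (ψ.trans σ).map .ltl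

/-- The accepting states: `(ψ₁ U ψ₂ < t)`, and the LTL formulas `¬(ψ₁ U ψ₂)`. -/
def IsAcc : AState AP → Prop
  | lt (.til _ _) _ => True
  | ltl (.neg (.til _ _)) => True
  | _ => False

/-- The states that are generated from `s₀` by the transition function. -/
inductive Reachable (s₀ : AState AP) : AState AP → Prop
  | init : Reachable s₀ s₀
  | step {s s' : AState AP} (σ : Set AP) :
      Reachable s₀ s → s' ∈ (s.trans σ).atoms → Reachable s₀ s'

end AState

/-- The automaton `A_{φ,v}`, over the alphabet `2^AP`: its initial state is `(φ > v)`, and its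
states are those that the transition function generates from it. -/
noncomputable def discAutomaton {AP : Type*} (φ : DFormula AP) (v : ℝ) :
    AltAutomaton (Set AP) {s : AState AP // (AState.gt φ v).Reachable s} where
  init := ⟨.gt φ v, .init⟩
  δ s σ := (s.1.trans σ).restrict fun _ h => s.2.step σ h
  acc := {s | s.1.IsAcc}

/-! ## Values of formulas -/

-- Each state makes an assertion about the remaining word, and `δ` unfolds it by one letter through
-- the fixpoint equations of the until operators. All thresholds are strict, so `t < sup` is always
-- witnessed by a single position. Hence, for every word, the states true at the current suffix form
-- an invariant set; each rejecting until state in it is eventually discharged at its witness, and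
-- the word is accepted (`sat_trans_iff`, `accepts_of_invariant`).
--
-- The converse fails for arbitrary words, because a supremum may equal a bound that none of its
-- terms reaches. For example, `True U ¬(True U_η p)` has value 1 when `p` recurs infinitely often
-- with unbounded gaps, yet its `φ^{<1}` holds. On a word with finitely many suffixes each formula
-- takes finitely many values, suprema are attained, and acceptance does imply `v < ⟦π, φ⟧`
-- (`le_value_til_iff`, `holds_of_dag`). This suffices for nonemptiness: cutting a run dag between
-- two equal levels that are far enough apart turns any accepted word into an accepted ultimately
-- periodic one (`Accepts.exists_lasso`).
--
-- Finiteness and weakness come from one well-founded rank: assertions lie above LTL formulas, then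
-- formula size counts, then the number of shifts until the discount falls below the threshold.
-- Every transition lowers the rank or is a self-loop.

theorem DiscountFun.pos (η : DiscountFun) (i : ℕ) : 0 < η i :=
  lt_of_le_of_lt (η.mem_Icc (i + 1)).1 (η.strictAnti (Nat.lt_succ_self i))

theorem DiscountFun.le_one (η : DiscountFun) (i : ℕ) : η i ≤ 1 := (η.mem_Icc i).2

theorem DiscountFun.shift_apply (η : DiscountFun) (k i : ℕ) : η.shift k i = η (i + k) := rfl

section Words

variable {A : Type*}

@[simp] theorem wordSuffix_apply (w : ℕ → A) (i n : ℕ) : wordSuffix w i n = w (i + n) := rfl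

@[simp] theorem wordSuffix_zero (w : ℕ → A) : wordSuffix w 0 = w := by
  funext n; simp

@[simp] theorem wordSuffix_wordSuffix (w : ℕ → A) (i j : ℕ) :
    wordSuffix (wordSuffix w i) j = wordSuffix w (i + j) := by
  funext n; simp [add_assoc]

/-- The word has finitely many different suffixes; equivalently, it is ultimately periodic. -/
def FinitelyManySuffixes (w : ℕ → A) : Prop := (Set.range (wordSuffix w)).Finite

theorem FinitelyManySuffixes.suffix {w : ℕ → A} (h : FinitelyManySuffixes w) (i : ℕ) :
    FinitelyManySuffixes (wordSuffix w i) := by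
  refine h.subset ?_
  rintro _ ⟨j, rfl⟩
  exact ⟨i + j, by simp⟩

end Words

namespace DFormula

variable {AP : Type*}

theorem bddAbove_fold_min {b : ℕ → ℝ} (f : ℕ → ℝ) {c : ℝ} (hb : ∀ i, b i ≤ c) :
    BddAbove (Set.range fun i : ℕ => (Finset.range i).fold min (b i) f) :=
  ⟨c, by rintro _ ⟨i, rfl⟩; exact (Finset.fold_min_le c).2 (Or.inl (hb i))⟩

/-- A strict bound below a supremum has a witness even when the supremum is not attained. For `≤`
this fails, which is the source of every periodicity hypothesis below. -/
theorem lt_iSup_fold_min_iff {b f : ℕ → ℝ} {c t : ℝ} (hb : ∀ i, b i ≤ c) :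
    t < (⨆ i : ℕ, (Finset.range i).fold min (b i) f) ↔ ∃ i, t < b i ∧ ∀ j < i, t < f j := by
  rw [lt_ciSup_iff (bddAbove_fold_min f hb)]
  simp [Finset.lt_fold_min]

theorem iSup_fold_min_mem_Icc {b f : ℕ → ℝ} {c : ℝ} (hb : ∀ i, b i ∈ Set.Icc 0 c) :
    (⨆ i : ℕ, (Finset.range i).fold min (b i) f) ∈ Set.Icc 0 c := by
  refine ⟨le_trans (hb 0).1 ?_, ciSup_le fun i => (Finset.fold_min_le c).2 (Or.inl (hb i).2)⟩
  exact le_ciSup (bddAbove_fold_min f fun i => (hb i).2) 0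

theorem value_mem_Icc (φ : DFormula AP) : ∀ π, φ.value π ∈ Set.Icc (0 : ℝ) 1 := by
  induction φ with
  | tt => intro π; simp [value]
  | atom p => intro π; simp only [value]; split <;> simp
  | neg φ ih => intro π; have := ih π; simp only [value, Set.mem_Icc] at *; constructor <;> linarith
  | or φ ψ ih₁ ih₂ =>
    intro π
    exact ⟨le_max_of_le_left (ih₁ π).1, max_le (ih₁ π).2 (ih₂ π).2⟩
  | next φ ih => intro π; exact ih _
  | til φ ψ ih₁ ih₂ =>
    intro π
    exact iSup_fold_min_mem_Icc fun i => ih₂ _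
  | dtil η φ ψ ih₁ ih₂ =>
    intro π
    exact iSup_fold_min_mem_Icc fun i =>
      ⟨mul_nonneg (η.pos i).le (ih₂ _).1, mul_le_one₀ (η.le_one i) (ih₂ _).1 (ih₂ _).2⟩

theorem lt_value_til_iff {φ ψ : DFormula AP} {π : ℕ → Set AP} {t : ℝ} :
    t < (til φ ψ).value π ↔
      ∃ i, t < ψ.value (wordSuffix π i) ∧ ∀ j < i, t < φ.value (wordSuffix π j) :=
  lt_iSup_fold_min_iff (c := 1) fun i => (value_mem_Icc ψ (wordSuffix π i)).2

theorem mul_value_le (η : DiscountFun) (ψ : DFormula AP) (π : ℕ → Set AP) (i : ℕ) :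
    η i * ψ.value π ≤ η 0 :=
  (mul_le_of_le_one_right (η.pos i).le (value_mem_Icc ψ π).2).trans
    (η.strictAnti.antitone (Nat.zero_le i))

theorem lt_value_dtil_iff {η : DiscountFun} {φ ψ : DFormula AP} {π : ℕ → Set AP} {t : ℝ} :
    t < (dtil η φ ψ).value π ↔
      ∃ i, t < η i * ψ.value (wordSuffix π i) ∧ ∀ j < i, t < η j * φ.value (wordSuffix π j) :=
  lt_iSup_fold_min_iff (c := η 0) fun i => mul_value_le η ψ (wordSuffix π i) i

/-- This bound justifies the constant transitions for `t / η 0 ≥ 1` in `(· > t)` and for `t / η 0 >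
1` in `(· < t)`. -/
theorem value_dtil_le (η : DiscountFun) (φ ψ : DFormula AP) (π : ℕ → Set AP) :
    (dtil η φ ψ).value π ≤ η 0 := by
  refine (iSup_fold_min_mem_Icc fun i => ?_).2
  exact ⟨mul_nonneg (η.pos i).le (value_mem_Icc ψ _).1, mul_value_le η ψ _ i⟩

theorem value_til (φ ψ : DFormula AP) (π : ℕ → Set AP) :
    (til φ ψ).value π =
      max (ψ.value π) (min (φ.value π) ((til φ ψ).value (wordSuffix π 1))) := by
  refine eq_of_forall_lt_iff fun t => ?_
  rw [lt_max_iff, lt_min_iff, lt_value_til_iff, lt_value_til_iff]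
  constructor
  · rintro ⟨_ | i, h, h'⟩
    · exact Or.inl (by simpa using h)
    · refine Or.inr ⟨by simpa using h' 0 (Nat.succ_pos i), i, ?_, fun j hj => ?_⟩
      · simpa [add_comm] using h
      · simpa [add_comm] using h' (j + 1) (Nat.succ_lt_succ hj)
  · rintro (h | ⟨h₀, i, h, h'⟩)
    · exact ⟨0, by simpa using h, by simp⟩
    · refine ⟨i + 1, by simpa [add_comm] using h, ?_⟩
      rintro (_ | j) hj
      · simpa using h₀
      · simpa [add_comm] using h' j (Nat.lt_of_succ_lt_succ hj)

/-- Separating position 0 from the rest replaces `η` by its shift. The remaining obligation keeps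
the threshold `t`, while the arguments `φ`, `ψ` are compared with `t / η 0`. -/
theorem value_dtil (η : DiscountFun) (φ ψ : DFormula AP) (π : ℕ → Set AP) :
    (dtil η φ ψ).value π = max (η 0 * ψ.value π)
      (min (η 0 * φ.value π) ((dtil (η.shift 1) φ ψ).value (wordSuffix π 1))) := by
  refine eq_of_forall_lt_iff fun t => ?_
  rw [lt_max_iff, lt_min_iff, lt_value_dtil_iff, lt_value_dtil_iff]
  constructor
  · rintro ⟨_ | i, h, h'⟩
    · exact Or.inl (by simpa using h)
    · refine Or.inr ⟨by simpa using h' 0 (Nat.succ_pos i), i, ?_, fun j hj => ?_⟩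
      · simpa [add_comm, DiscountFun.shift_apply] using h
      · simpa [add_comm, DiscountFun.shift_apply] using h' (j + 1) (Nat.succ_lt_succ hj)
  · rintro (h | ⟨h₀, i, h, h'⟩)
    · exact ⟨0, by simpa using h, by simp⟩
    · refine ⟨i + 1, by simpa [add_comm, DiscountFun.shift_apply] using h, ?_⟩
      rintro (_ | j) hj
      · simpa using h₀
      · simpa [add_comm, DiscountFun.shift_apply] using h' j (Nat.lt_of_succ_lt_succ hj)

theorem finite_range_value {π : ℕ → Set AP} (hπ : FinitelyManySuffixes π) (φ : DFormula AP) :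
    (Set.range fun i => φ.value (wordSuffix π i)).Finite := by
  have := Set.Finite.image φ.value hπ
  rwa [← Set.range_comp] at this

/-- On words with finitely many suffixes the supremum of an until formula is attained. -/
theorem le_value_til_iff {φ ψ : DFormula AP} {π : ℕ → Set AP} (hπ : FinitelyManySuffixes π)
    {t : ℝ} :
    t ≤ (til φ ψ).value π ↔
      ∃ i, t ≤ ψ.value (wordSuffix π i) ∧ ∀ j < i, t ≤ φ.value (wordSuffix π j) := by
  set F : ℕ → ℝ := fun i => (Finset.range i).fold min (ψ.value (wordSuffix π i))
    (fun j => φ.value (wordSuffix π j)) with hF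
  have hbdd : BddAbove (Set.range F) :=
    bddAbove_fold_min _ (c := 1) fun i => (value_mem_Icc ψ (wordSuffix π i)).2
  have hle : ∀ i, t ≤ F i ↔
      t ≤ ψ.value (wordSuffix π i) ∧ ∀ j < i, t ≤ φ.value (wordSuffix π j) := fun i => by
    simp [hF, Finset.le_fold_min]
  have hfin : (Set.range F).Finite := by
    refine ((finite_range_value hπ φ).union (finite_range_value hπ ψ)).subset ?_
    -- A minimum equals one of its arguments, so all terms of the supremum lie in the finitely many
    -- values of `φ` and `ψ`.
    have key : ∀ (s : Finset ℕ) (b : ℝ) (f : ℕ → ℝ),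
        s.fold min b f = b ∨ ∃ j, s.fold min b f = f j := by
      intro s b f
      induction s using Finset.induction_on with
      | empty => simp
      | insert a s ha ih =>
        rw [Finset.fold_insert ha]
        rcases min_choice (f a) (s.fold min b f) with h | h
        · exact Or.inr ⟨a, h⟩
        · rw [h]; exact ih
    rintro _ ⟨i, rfl⟩
    rcases key (Finset.range i) (ψ.value (wordSuffix π i)) (fun j => φ.value (wordSuffix π j))
      with h | ⟨j, h⟩
    · exact Or.inr ⟨i, h.symm⟩
    · exact Or.inl ⟨j, h.symm⟩
  obtain ⟨i, hi⟩ : (⨆ i, F i) ∈ Set.range F := (Set.range_nonempty F).csSup_mem hfin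
  change t ≤ (⨆ i, F i) ↔ _
  constructor
  · intro h
    exact ⟨i, (hle i).1 (hi ▸ h)⟩
  · rintro ⟨k, hk⟩
    exact ((hle k).2 hk).trans (le_ciSup hbdd k)

end DFormula

/-! ## Boolean semantics of LTL -/

namespace LTLFormula

variable {AP : Type*}

/-- Satisfaction of an LTL formula in a computation. -/
def Holds : LTLFormula AP → (ℕ → Set AP) → Prop
  | .tt, _ => True
  | .atom p, π => p ∈ π 0
  | .neg φ, π => ¬ φ.Holds π
  | .or φ ψ, π => φ.Holds π ∨ ψ.Holds π
  | .next φ, π => φ.Holds (wordSuffix π 1)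
  | .til φ ψ, π => ∃ i, ψ.Holds (wordSuffix π i) ∧ ∀ j < i, φ.Holds (wordSuffix π j)

theorem holds_and {φ ψ : LTLFormula AP} {π : ℕ → Set AP} :
    (φ.and ψ).Holds π ↔ φ.Holds π ∧ ψ.Holds π := by
  simp only [LTLFormula.and, Holds]; tauto

theorem holds_compl {φ : LTLFormula AP} {π : ℕ → Set AP} :
    φ.compl.Holds π ↔ ¬ φ.Holds π := by
  cases φ <;> simp [compl, Holds]

theorem holds_til {φ ψ : LTLFormula AP} {π : ℕ → Set AP} :
    (til φ ψ).Holds π ↔ ψ.Holds π ∨ φ.Holds π ∧ (til φ ψ).Holds (wordSuffix π 1) := by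
  simp only [Holds]
  constructor
  · rintro ⟨_ | i, h, h'⟩
    · exact Or.inl (by simpa using h)
    · refine Or.inr ⟨by simpa using h' 0 (Nat.succ_pos i), i, ?_, fun j hj => ?_⟩
      · simpa [add_comm] using h
      · simpa [add_comm] using h' (j + 1) (Nat.succ_lt_succ hj)
  · rintro (h | ⟨h₀, i, h, h'⟩)
    · exact ⟨0, by simpa using h, by simp⟩
    · refine ⟨i + 1, by simpa [add_comm] using h, ?_⟩
      rintro (_ | j) hj
      · simpa using h₀
      · simpa [add_comm] using h' j (Nat.lt_of_succ_lt_succ hj)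

end LTLFormula

-- The formulas `φ⁺` and `φ^{<1}` compared with the values

namespace DFormula

variable {AP : Type*}

/-- Beyond position 0 every term is at most `η 1 < 1`, so only `η 0 * ψ` can bring the value up to
1. -/
theorem value_dtil_lt_one_iff {η : DiscountFun} {φ ψ : DFormula AP} {π : ℕ → Set AP} :
    (dtil η φ ψ).value π < 1 ↔ η 0 < 1 ∨ ψ.value π < 1 := by
  have h₁ : (dtil (η.shift 1) φ ψ).value (wordSuffix π 1) < 1 :=
    lt_of_le_of_lt (value_dtil_le _ _ _ _)
      (lt_of_lt_of_le (η.strictAnti (by simp : 0 < 0 + 1)) (η.le_one 0))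
  rw [value_dtil, max_lt_iff, min_lt_iff]
  simp only [h₁, or_true, and_true]
  have hψ := value_mem_Icc ψ π
  rcases (η.le_one 0).lt_or_eq with h | h
  · exact ⟨fun _ => Or.inl h, fun _ =>
      lt_of_le_of_lt (mul_le_of_le_one_right (η.pos 0).le hψ.2) h⟩
  · simp [h]

theorem value_dtil_pos_iff {η : DiscountFun} {φ ψ : DFormula AP} {π : ℕ → Set AP} :
    0 < (dtil η φ ψ).value π ↔
      ∃ i, 0 < ψ.value (wordSuffix π i) ∧ ∀ j < i, 0 < φ.value (wordSuffix π j) := by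
  rw [lt_value_dtil_iff]
  simp only [mul_pos_iff_of_pos_left (η.pos _)]

/-- Both halves are proved together because negation exchanges them. This direction needs no
periodicity: a position refuting `φ^{<1}` for an until is an actual term of the supremum. -/
theorem holds_pos_and_holds_ltOne (φ : DFormula AP) :
    ∀ π : ℕ → Set AP, (0 < φ.value π → φ.pos.Holds π) ∧ (φ.value π < 1 → φ.ltOne.Holds π) := by
  induction φ with
  | tt => intro π; simp [value, pos, ltOne, LTLFormula.Holds]
  | atom p =>
    intro π
    by_cases h : p ∈ π 0 <;> simp [value, pos, ltOne, LTLFormula.Holds, h]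
  | neg φ ih =>
    intro π
    simp only [value, pos, ltOne]
    exact ⟨fun h => (ih π).2 (by linarith), fun h => (ih π).1 (by linarith)⟩
  | or φ ψ ih₁ ih₂ =>
    intro π
    simp only [value, pos, ltOne, LTLFormula.holds_and, lt_max_iff, max_lt_iff]
    exact ⟨Or.imp (ih₁ π).1 (ih₂ π).1, And.imp (ih₁ π).2 (ih₂ π).2⟩
  | next φ ih => intro π; exact ih _
  | til φ ψ ih₁ ih₂ =>
    intro π
    constructor
    · rw [lt_value_til_iff]
      rintro ⟨i, h, h'⟩
      exact ⟨i, (ih₂ _).1 h, fun j hj => (ih₁ _).1 (h' j hj)⟩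
    · rintro h ⟨i, h₁, h₂⟩
      refine not_le_of_gt h (le_of_forall_lt fun c hc => lt_value_til_iff.2 ⟨i, ?_, fun j hj => ?_⟩)
      · exact hc.trans_le (not_lt.1 fun h' => h₁ ((ih₂ _).2 h'))
      · exact hc.trans_le (not_lt.1 fun h' => h₂ j hj ((ih₁ _).2 h'))
  | dtil η φ ψ ih₁ ih₂ =>
    intro π
    constructor
    · rw [value_dtil_pos_iff]
      rintro ⟨i, h, h'⟩
      exact ⟨i, (ih₂ _).1 h, fun j hj => (ih₁ _).1 (h' j hj)⟩
    · rw [value_dtil_lt_one_iff]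
      intro h
      simp only [ltOne]
      split_ifs with h'
      · trivial
      · exact (ih₂ π).2 (h.resolve_left h')

/-- Periodicity is essential only in the `ltOne` half for the undiscounted until: value 1 must be
attained at some position to contradict the LTL formula. -/
theorem value_of_holds_pos_and_ltOne (φ : DFormula AP) :
    ∀ π : ℕ → Set AP, FinitelyManySuffixes π →
      (φ.pos.Holds π → 0 < φ.value π) ∧ (φ.ltOne.Holds π → φ.value π < 1) := by
  induction φ with
  | tt => intro π _; simp [value, ltOne, LTLFormula.Holds]
  | atom p =>
    intro π _
    by_cases h : p ∈ π 0 <;> simp [value, pos, ltOne, LTLFormula.Holds, h]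
  | neg φ ih =>
    intro π hπ
    simp only [value, pos, ltOne]
    exact ⟨fun h => sub_pos.2 ((ih π hπ).2 h), fun h => by linarith [(ih π hπ).1 h]⟩
  | or φ ψ ih₁ ih₂ =>
    intro π hπ
    simp only [value, pos, ltOne, LTLFormula.holds_and, lt_max_iff, max_lt_iff]
    exact ⟨Or.imp (ih₁ π hπ).1 (ih₂ π hπ).1, And.imp (ih₁ π hπ).2 (ih₂ π hπ).2⟩
  | next φ ih => intro π hπ; exact ih _ (hπ.suffix 1)
  | til φ ψ ih₁ ih₂ =>
    intro π hπ
    constructor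
    · rintro ⟨i, h, h'⟩
      exact lt_value_til_iff.2
        ⟨i, (ih₂ _ (hπ.suffix i)).1 h, fun j hj => (ih₁ _ (hπ.suffix j)).1 (h' j hj)⟩
    · intro h
      by_contra hlt
      obtain ⟨i, h₁, h₂⟩ := (le_value_til_iff hπ).1 (not_lt.1 hlt)
      exact h ⟨i, fun h' => not_lt.2 h₁ ((ih₂ _ (hπ.suffix i)).2 h'),
        fun j hj h' => not_lt.2 (h₂ j hj) ((ih₁ _ (hπ.suffix j)).2 h')⟩
  | dtil η φ ψ ih₁ ih₂ =>
    intro π hπ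
    constructor
    · rintro ⟨i, h, h'⟩
      exact value_dtil_pos_iff.2
        ⟨i, (ih₂ _ (hπ.suffix i)).1 h, fun j hj => (ih₁ _ (hπ.suffix j)).1 (h' j hj)⟩
    · rw [value_dtil_lt_one_iff]
      simp only [ltOne]
      split_ifs with h'
      · exact fun _ => Or.inl h'
      · exact fun h => Or.inr ((ih₂ π hπ).2 h)

end DFormula
/-! ## Generic facts on alternating automata -/

namespace AltAutomaton

variable {A Q : Type*}

/-- There is a path of `n` edges from `(q, l)` that avoids the accepting states. -/
def AvoidsFor (M : AltAutomaton A Q) (E : ℕ → Q → Q → Prop) : ℕ → ℕ → Q → Prop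
  | 0, _, q => q ∉ M.acc
  | n + 1, l, q => q ∉ M.acc ∧ ∃ q', E l q q' ∧ M.AvoidsFor E n (l + 1) q'

theorem AvoidsFor.not_mem {M : AltAutomaton A Q} {E : ℕ → Q → Q → Prop} {n l : ℕ} {q : Q}
    (h : M.AvoidsFor E n l q) : q ∉ M.acc := by
  cases n
  · exact h
  · exact h.1

theorem AvoidsFor.of_succ {M : AltAutomaton A Q} {E : ℕ → Q → Q → Prop} {n : ℕ} :
    ∀ {l : ℕ} {q : Q}, M.AvoidsFor E (n + 1) l q → M.AvoidsFor E n l q := by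
  induction n with
  | zero => exact fun h => h.1
  | succ n ih => exact fun ⟨h, q', hq', h'⟩ => ⟨h, q', hq', ih h'⟩

theorem AvoidsFor.mono {M : AltAutomaton A Q} {E : ℕ → Q → Q → Prop} {m n l : ℕ} {q : Q}
    (hmn : m ≤ n) (h : M.AvoidsFor E n l q) : M.AvoidsFor E m l q := by
  induction n, hmn using Nat.le_induction with
  | base => exact h
  | succ n _ ih => exact ih h.of_succ

theorem avoidsFor_of_path {M : AltAutomaton A Q} {E : ℕ → Q → Q → Prop} (n : ℕ) :
    ∀ (l : ℕ) (ρ : ℕ → Q), (∀ k < n, E (l + k) (ρ k) (ρ (k + 1))) →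
      (∀ k ≤ n, ρ k ∉ M.acc) → M.AvoidsFor E n l (ρ 0) := by
  induction n with
  | zero => exact fun l ρ _ h => h 0 le_rfl
  | succ n ih =>
    intro l ρ hE h
    refine ⟨h 0 (Nat.zero_le _), ρ 1, hE 0 (Nat.succ_pos n), ?_⟩
    refine ih (l + 1) (fun k => ρ (k + 1)) (fun k hk => ?_) fun k hk => h _ (Nat.succ_le_succ hk)
    have := hE (k + 1) (Nat.succ_lt_succ hk)
    rwa [← add_assoc, add_right_comm] at this

/-- Finiteness of `ι` exchanges the quantifiers; this is the finite-branching ingredient of König's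
lemma. -/
theorem exists_bound_of_antitone {ι : Type*} [Finite ι] {P : ℕ → ι → Prop}
    (hP : ∀ m n i, m ≤ n → P n i → P m i) (h : ∀ i, ∃ n, ¬ P n i) : ∃ n, ∀ i, ¬ P n i := by
  choose f hf using h
  obtain ⟨N, hN⟩ := (Set.finite_range f).bddAbove
  exact ⟨N, fun i hi => hf i (hP _ _ i (hN ⟨i, rfl⟩) hi)⟩

/-- In an accepting dag, the paths from a level that avoid the accepting states are of bounded
length. -/
theorem AcceptingDag.exists_not_avoidsFor [Finite Q] {M : AltAutomaton A Q}
    {E : ℕ → Q → Q → Prop} (hE : M.AcceptingDag E) (l : ℕ) :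
    ∃ n, ∀ q, ¬ M.AvoidsFor E n l q := by
  refine exists_bound_of_antitone (fun m n q hmn h => h.mono hmn) fun q => ?_
  by_contra! hq
  -- König's lemma: a node with arbitrarily long avoiding paths has a successor of the same kind,
  -- since otherwise one bound would serve all successors. Iterating gives an infinite path without
  -- accepting states.
  have step : ∀ (l : ℕ) (q : Q), (∀ n, M.AvoidsFor E n l q) →
      ∃ q', E l q q' ∧ ∀ n, M.AvoidsFor E n (l + 1) q' := by
    intro l q h
    by_contra! hcon
    obtain ⟨n, hn⟩ := exists_bound_of_antitone
      (P := fun n q' => E l q q' ∧ M.AvoidsFor E n (l + 1) q')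
      (fun m n q' hmn h => ⟨h.1, h.2.mono hmn⟩) (fun q' => by
        by_cases hq' : E l q q'
        · exact (hcon q' hq').imp fun n hn h => hn h.2
        · exact ⟨0, fun h => hq' h.1⟩)
    obtain ⟨-, q', h₁, h₂⟩ := h (n + 1)
    exact hn q' ⟨h₁, h₂⟩
  choose! next hnext using step
  let ρ : ℕ → Q := fun i => Nat.rec q (fun k q => next (l + k) q) i
  have hρ : ∀ i n, M.AvoidsFor E n (l + i) (ρ i) := by
    intro i
    induction i with
    | zero => exact hq
    | succ i ih => exact (hnext (l + i) (ρ i) ih).2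
  obtain ⟨i, -, hi⟩ := hE l ρ (fun i => (hnext (l + i) (ρ i) (hρ i)).1) 0
  exact (hρ i 0).not_mem hi

/-- The successor of a position in a lasso that returns from `j - 1` to `i`. -/
def lassoNext (i j x : ℕ) : ℕ := if x + 1 = j then i else x + 1

theorem lassoNext_lt {i j x : ℕ} (hij : i < j) (hx : x < j) : lassoNext i j x < j := by
  unfold lassoNext; split_ifs <;> omega

theorem iterate_lassoNext_lt {i j x : ℕ} (hij : i < j) (hx : x < j) (n : ℕ) :
    (lassoNext i j)^[n] x < j := by
  induction n with
  | zero => exact hx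
  | succ n ih => rw [Function.iterate_succ_apply']; exact lassoNext_lt hij ih

theorem iterate_lassoNext_eq_add {i j x k : ℕ} (hk : x + k < j) :
    (lassoNext i j)^[k] x = x + k := by
  induction k with
  | zero => rfl
  | succ k ih =>
    rw [Function.iterate_succ_apply', ih (by omega), lassoNext, if_neg (by omega), add_assoc]

theorem exists_iterate_lassoNext_eq {i j x : ℕ} (hx : x < j) :
    ∃ k, (lassoNext i j)^[k] x = i := by
  refine ⟨(j - 1 - x) + 1, ?_⟩
  rw [Function.iterate_succ_apply', iterate_lassoNext_eq_add (by omega), lassoNext,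
    if_pos (by omega)]

/-- An accepted word can be replaced by an accepted ultimately periodic one. -/
theorem Accepts.exists_lasso [Finite Q] {M : AltAutomaton A Q} {w : ℕ → A} (h : M.Accepts w) :
    ∃ w', M.Accepts w' ∧ (Set.range (wordSuffix w')).Finite := by
  obtain ⟨V, E, hrun, hacc⟩ := h
  -- There are finitely many sets of states, so some set occurs as a level infinitely often.
  obtain ⟨S, hS⟩ := Finite.exists_infinite_fiber V
  have hS : (V ⁻¹' {S}).Infinite := Set.infinite_coe_iff.1 hS
  obtain ⟨i, hi⟩ := hS.nonempty
  -- Choosing the repeated level `j` beyond `i + n` makes the loop so long that every path through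
  -- it meets an accepting state before returning to `i`.
  obtain ⟨n, hn⟩ := hacc.exists_not_avoidsFor i
  obtain ⟨j, hj, hij⟩ := hS.exists_gt (i + n)
  have hVij : V j = V i := by rw [Set.mem_preimage, Set.mem_singleton_iff] at hi hj; rw [hi, hj]
  have hlt : i < j := by omega
  set f : ℕ → ℕ := fun l => (lassoNext i j)^[l] 0 with hf
  have hfadd : ∀ l k, f (l + k) = (lassoNext i j)^[k] (f l) := fun l k => by
    rw [hf, add_comm]; exact Function.iterate_add_apply _ _ _ _
  have hflt : ∀ l, f l < j := iterate_lassoNext_lt hlt (by omega)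
  have hV : ∀ l, V (f (l + 1)) = V (f l + 1) := fun l => by
    rw [hfadd l 1, Function.iterate_one, lassoNext]
    split_ifs with h
    · rw [h, hVij]
    · rfl
  refine ⟨fun l => w (f l), ⟨fun l => V (f l), fun l => E (f l), ⟨hrun.root, ?_, ?_, ?_⟩, ?_⟩, ?_⟩
  · intro l q q' h
    rw [hV]
    exact hrun.edge_mem _ _ _ h
  · exact fun l q hq => hrun.sat _ q hq
  · intro l q' hq'
    rw [hV] at hq'
    exact hrun.minimal _ _ hq'
  · intro l ρ hρ m
    -- After step `m` the path comes back to level `i`; its next `n` edges are edges of the original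
    -- dag, since `i + n < j`.
    obtain ⟨k, hk⟩ := exists_iterate_lassoNext_eq (i := i) (hflt (l + m))
    rw [← hfadd] at hk
    by_contra! hcon
    refine hn (ρ (m + k)) (avoidsFor_of_path n i (fun x => ρ (m + k + x)) (fun x hx => ?_)
      fun x _ => hcon _ (by omega))
    have := hρ (m + k + x)
    rwa [show l + (m + k + x) = l + m + k + x by omega, hfadd, hk,
      iterate_lassoNext_eq_add (by omega)] at this
  · refine ((Set.finite_Iio j).image fun x k => w ((lassoNext i j)^[k] x)).subset ?_
    rintro _ ⟨l, rfl⟩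
    exact ⟨f l, hflt l, funext fun k => congrArg w (hfadd l k).symm⟩

end AltAutomaton

-- Positive Boolean formulas

namespace PosBool

variable {X Z : Type*}

theorem Sat.mono {Y Y' : Set X} {θ : PosBool X} (h : θ.Sat Y)
    (hY : ∀ x ∈ θ.atoms, x ∈ Y → x ∈ Y') : θ.Sat Y' := by
  induction θ with
  | tt => trivial
  | ff => exact h
  | atom x => exact hY x rfl h
  | and θ χ ih₁ ih₂ =>
    exact ⟨ih₁ h.1 fun x hx => hY x (Or.inl hx), ih₂ h.2 fun x hx => hY x (Or.inr hx)⟩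
  | or θ χ ih₁ ih₂ =>
    exact h.imp (fun h => ih₁ h fun x hx => hY x (Or.inl hx))
      (fun h => ih₂ h fun x hx => hY x (Or.inr hx))

theorem sat_map {f : X → Z} {Y : Set Z} {θ : PosBool X} :
    (θ.map f).Sat Y ↔ θ.Sat (f ⁻¹' Y) := by
  induction θ with
  | tt => rfl
  | ff => rfl
  | atom x => rfl
  | and θ χ ih₁ ih₂ => exact and_congr ih₁ ih₂
  | or θ χ ih₁ ih₂ => exact or_congr ih₁ ih₂

theorem atoms_map {f : X → Z} {θ : PosBool X} : (θ.map f).atoms = f '' θ.atoms := by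
  induction θ with
  | tt => simp [map, atoms]
  | ff => simp [map, atoms]
  | atom x => simp [map, atoms]
  | and θ χ ih₁ ih₂ => simp [map, atoms, ih₁, ih₂, Set.image_union]
  | or θ χ ih₁ ih₂ => simp [map, atoms, ih₁, ih₂, Set.image_union]

theorem sat_restrict {P : X → Prop} {Y : Set {x // P x}} {θ : PosBool X}
    (h : ∀ x ∈ θ.atoms, P x) : (θ.restrict h).Sat Y ↔ θ.Sat (Subtype.val '' Y) := by
  induction θ with
  | tt => rfl
  | ff => rfl
  | atom x =>
    simp only [restrict, Sat, Set.mem_image, Subtype.exists, exists_and_right, exists_eq_right]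
    exact ⟨fun hx => ⟨h x rfl, hx⟩, fun ⟨_, hx⟩ => hx⟩
  | and θ χ ih₁ ih₂ => exact and_congr (ih₁ _) (ih₂ _)
  | or θ χ ih₁ ih₂ => exact or_congr (ih₁ _) (ih₂ _)

theorem mem_atoms_restrict {P : X → Prop} {θ : PosBool X} (h : ∀ x ∈ θ.atoms, P x)
    {x : {x // P x}} : x ∈ (θ.restrict h).atoms ↔ x.1 ∈ θ.atoms := by
  induction θ with
  | tt => rfl
  | ff => rfl
  | atom y => simp [restrict, atoms, Subtype.ext_iff]
  | and θ χ ih₁ ih₂ => exact or_congr (ih₁ _) (ih₂ _)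
  | or θ χ ih₁ ih₂ => exact or_congr (ih₁ _) (ih₂ _)

theorem atoms_dual {AP : Type*} {θ : PosBool (LTLFormula AP)} :
    θ.dual.atoms = LTLFormula.compl '' θ.atoms := by
  induction θ with
  | tt => simp [dual, atoms]
  | ff => simp [dual, atoms]
  | atom x => simp [dual, atoms]
  | and θ χ ih₁ ih₂ => simp [dual, atoms, ih₁, ih₂, Set.image_union]
  | or θ χ ih₁ ih₂ => simp [dual, atoms, ih₁, ih₂, Set.image_union]

end PosBool

-- Criteria for acceptance and for weakness

namespace AltAutomaton

variable {A Q : Type*}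

/-- If `H l` is a set of states from which the automaton can proceed to `H (l + 1)`, the transitions
never increase a rank, and no rejecting state of `H` has to stay in place forever, then the
automaton accepts. -/
theorem accepts_of_invariant {R : Type*} [PartialOrder R] [WellFoundedLT R]
    (M : AltAutomaton A Q) (w : ℕ → A) (H : ℕ → Set Q) (rank : Q → R)
    (hinit : M.init ∈ H 0)
    (hstep : ∀ l, ∀ q ∈ H l, (M.δ q (w l)).Sat (H (l + 1)))
    (hrank : ∀ q a, ∀ s ∈ (M.δ q a).atoms, s = q ∨ rank s < rank q)
    (hleave : ∀ l q, q ∉ M.acc → (∀ i, q ∈ H (l + i)) →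
      ∃ i, (M.δ q (w (l + i))).Sat (H (l + i + 1) \ {q})) :
    M.Accepts w := by
  classical
  -- Among the successors in `H (l + 1)`, the state itself is dropped whenever the transition can be
  -- satisfied without it.
  let next : ℕ → Q → Set Q := fun l q =>
    if (M.δ q (w l)).Sat (H (l + 1) \ {q}) then {s ∈ (M.δ q (w l)).atoms | s ∈ H (l + 1) \ {q}}
    else {s ∈ (M.δ q (w l)).atoms | s ∈ H (l + 1)}
  have hnext_sub : ∀ l q, next l q ⊆ {s ∈ (M.δ q (w l)).atoms | s ∈ H (l + 1)} := by
    intro l q s hs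
    simp only [next] at hs
    split_ifs at hs
    · exact ⟨hs.1, hs.2.1⟩
    · exact hs
  have hnext_sat : ∀ l, ∀ q ∈ H l, (M.δ q (w l)).Sat (next l q) := by
    intro l q hq
    simp only [next]
    split_ifs with h
    · exact h.mono fun x hx h => ⟨hx, h⟩
    · exact (hstep l q hq).mono fun x hx h => ⟨hx, h⟩
  let V : ℕ → Set Q := fun l => Nat.rec {M.init} (fun l V => {s | ∃ q ∈ V, s ∈ next l q}) l
  have hV : ∀ l, V l ⊆ H l := by
    intro l
    induction l with
    | zero => rintro _ rfl; exact hinit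
    | succ l ih => rintro s ⟨q, -, hs⟩; exact (hnext_sub l q hs).2
  refine ⟨V, fun l q q' => q ∈ V l ∧ q' ∈ next l q, ⟨rfl, ?_, ?_, ?_⟩, ?_⟩
  · exact fun l q q' h => ⟨h.1, q, h⟩
  · exact fun l q hq => (hnext_sat l q (hV l hq)).mono fun x _ hx => ⟨hq, hx⟩
  · exact fun l q' ⟨q, h⟩ => ⟨q, h⟩
  · intro l ρ hρ n
    have hle : ∀ i, ρ (i + 1) = ρ i ∨ rank (ρ (i + 1)) < rank (ρ i) := fun i =>
      hrank _ _ _ (hnext_sub _ _ (hρ i).2).1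
    -- From a point of minimal rank on, a path can only follow self-loops. `hleave` then gives a
    -- level at which `next` has removed that self-loop.
    obtain ⟨m, hm⟩ : ∃ m, n ≤ m ∧ ∀ k, n ≤ k → ¬ rank (ρ k) < rank (ρ m) := by
      obtain ⟨_, ⟨m, hnm, rfl⟩, hm⟩ := wellFounded_lt.has_min ((fun k => rank (ρ k)) '' Set.Ici n)
        ⟨_, n, Set.self_mem_Ici, rfl⟩
      exact ⟨m, hnm, fun k hk => hm _ ⟨k, hk, rfl⟩⟩
    have hconst : ∀ k, ρ (m + k) = ρ m := by
      intro k
      induction k with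
      | zero => rfl
      | succ k ih =>
        refine ((hle (m + k)).resolve_right ?_).trans ih
        rw [ih]
        exact hm.2 _ (by omega)
    by_contra! hcon
    obtain ⟨i, hi⟩ := hleave (l + m) (ρ m) (hcon m hm.1) fun i => by
      have := hV _ (hρ (m + i)).1
      rwa [hconst, ← add_assoc] at this
    have := (hρ (m + i)).2
    rw [← add_assoc, add_assoc m, hconst, hconst] at this
    simp only [next] at this
    rw [if_pos (by convert hi using 3)] at this
    exact this.2.2 rfl

/-- An automaton is weak if its transitions, except for self-loops, strictly decrease a rank. -/
theorem isWeak_of_rank {R : Type*} [PartialOrder R] [Finite Q] (M : AltAutomaton A Q)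
    (rank : Q → R) (hrank : ∀ q a, ∀ s ∈ (M.δ q a).atoms, s = q ∨ rank s < rank q) :
    M.IsWeak := by
  let e := Finite.equivFin Q
  -- The classes are singletons, hence purely accepting or rejecting, and the order is equality or
  -- strictly smaller rank.
  refine ⟨Nat.card Q, e,
    { le := fun i j => e.symm i = e.symm j ∨ rank (e.symm i) < rank (e.symm j)
      lt := fun i j => (e.symm i = e.symm j ∨ rank (e.symm i) < rank (e.symm j)) ∧
        ¬ (e.symm j = e.symm i ∨ rank (e.symm j) < rank (e.symm i))
      lt_iff_le_not_ge := fun _ _ => Iff.rfl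
      le_refl := fun i => Or.inl rfl
      le_trans := ?_
      le_antisymm := ?_ }, e.surjective, ?_, ?_⟩
  · rintro i j k (h | h) (h' | h')
    · exact Or.inl (h.trans h')
    · exact Or.inr (h ▸ h')
    · exact Or.inr (h' ▸ h)
    · exact Or.inr (h.trans h')
  · rintro i j (h | h) (h' | h')
    · exact e.symm.injective h
    · exact e.symm.injective h
    · exact e.symm.injective h'.symm
    · exact absurd h' h.asymm
  · intro i
    by_cases h : e.symm i ∈ M.acc
    · exact Or.inl fun q hq => by rwa [← hq, e.symm_apply_apply] at h
    · exact Or.inr fun q hq => by rwa [← hq, e.symm_apply_apply] at h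
  · intro q a s hs
    change e.symm (e s) = e.symm (e q) ∨ rank (e.symm (e s)) < rank (e.symm (e q))
    simpa using hrank q a s hs

end AltAutomaton
/-! ## Ranks of states -/

/-- The size of an LTL formula. -/
def LTLFormula.size {AP : Type*} : LTLFormula AP → ℕ
  | .tt => 1
  | .atom _ => 1
  | .neg φ => φ.size + 1
  | .or φ ψ => φ.size + ψ.size + 1
  | .next φ => φ.size + 1
  | .til φ ψ => φ.size + ψ.size + 1

/-- The size of a formula of discounted LTL. -/
def DFormula.size {AP : Type*} : DFormula AP → ℕ
  | .tt => 1
  | .atom _ => 1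
  | .neg φ => φ.size + 1
  | .or φ ψ => φ.size + ψ.size + 1
  | .next φ => φ.size + 1
  | .til φ ψ => φ.size + ψ.size + 1
  | .dtil _ φ ψ => φ.size + ψ.size + 1

/-- For a discounted until formula, the number of shifts after which the discounting function
falls below the threshold `t`. -/
noncomputable def DFormula.shiftsBelow {AP : Type*} : DFormula AP → ℝ → ℕ
  | .dtil η _ _, t => sInf {k | η k < t}
  | _, _ => 0

/-- A rank that transitions, except for self-loops, decrease. -/
noncomputable def AState.rank {AP : Type*} : AState AP → ℕ ×ₗ ℕ ×ₗ ℕ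
  | .gt ψ t => toLex (1, toLex (ψ.size, ψ.shiftsBelow t))
  | .lt ψ t => toLex (1, toLex (ψ.size, ψ.shiftsBelow t))
  | .ltl ψ => toLex (0, toLex (ψ.size, 0))

/-- The states that can have self-loops. -/
def AState.IsUntil {AP : Type*} : AState AP → Prop
  | .gt (.til _ _) _ => True
  | .lt (.til _ _) _ => True
  | .ltl (.til _ _) => True
  | .ltl (.neg (.til _ _)) => True
  | _ => False

namespace LTLFormula

variable {AP : Type*}

theorem size_compl_le (φ : LTLFormula AP) : φ.compl.size ≤ φ.size + 1 := by
  cases φ <;> simp only [compl, size] <;> omega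

theorem size_pos (φ : LTLFormula AP) : 0 < φ.size := by
  cases φ <;> simp [size]

theorem size_lt_of_mem_atoms_trans {σ : Set AP} (ψ : LTLFormula AP) :
    ∀ x ∈ (ψ.trans σ).atoms, x.size < ψ.size ∨ x = ψ ∧ (AState.ltl ψ).IsUntil := by
  induction ψ with
  | tt => simp [trans, PosBool.atoms]
  | atom p => simp only [trans]; split_ifs <;> simp [PosBool.atoms]
  | neg φ ih =>
    intro x hx
    rw [trans, PosBool.atoms_dual] at hx
    obtain ⟨y, hy, rfl⟩ := hx
    rcases ih y hy with h | ⟨rfl, h⟩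
    -- Complementing costs at most one, which the outer negation pays for. If `y` is the negated
    -- formula itself, it is an until, giving a self-loop, or a negation, whose complement is
    -- smaller.
    · have := y.size_compl_le
      exact Or.inl (by simp only [size]; omega)
    · cases y with
      | til a b => exact Or.inr ⟨rfl, trivial⟩
      | neg y => exact Or.inl (by simp only [compl, size]; omega)
      | _ => exact h.elim
  | or φ ψ ih₁ ih₂ =>
    rintro x (hx | hx)
    · left; rcases ih₁ x hx with h | ⟨rfl, -⟩ <;> simp only [size] <;> omega
    · left; rcases ih₂ x hx with h | ⟨rfl, -⟩ <;> simp only [size] <;> omega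
  | next φ ih =>
    rintro x rfl
    exact Or.inl (Nat.lt_succ_self _)
  | til φ ψ ih₁ ih₂ =>
    rintro x (hx | hx | hx)
    · left; rcases ih₂ x hx with h | ⟨rfl, -⟩ <;> simp only [size] <;> omega
    · left; rcases ih₁ x hx with h | ⟨rfl, -⟩ <;> simp only [size] <;> omega
    · exact Or.inr ⟨hx, trivial⟩

/-- The alphabet `2^AP` may be infinite, so finite branching requires a bound that is uniform in the
letter. -/
theorem exists_finite_atoms_trans (ψ : LTLFormula AP) :
    ∃ B : Set (LTLFormula AP), B.Finite ∧ ∀ σ, (ψ.trans σ).atoms ⊆ B := by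
  induction ψ with
  | tt => exact ⟨∅, Set.finite_empty, fun σ => by simp [trans, PosBool.atoms]⟩
  | atom p =>
    exact ⟨∅, Set.finite_empty, fun σ => by simp only [trans]; split_ifs <;> simp [PosBool.atoms]⟩
  | neg φ ih =>
    obtain ⟨B, hB, h⟩ := ih
    exact ⟨compl '' B, hB.image _, fun σ => by
      rw [trans, PosBool.atoms_dual]; exact Set.image_mono (h σ)⟩
  | or φ ψ ih₁ ih₂ =>
    obtain ⟨B, hB, h⟩ := ih₁
    obtain ⟨C, hC, h'⟩ := ih₂
    exact ⟨B ∪ C, hB.union hC, fun σ => Set.union_subset_union (h σ) (h' σ)⟩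
  | next φ ih => exact ⟨{φ}, Set.finite_singleton _, fun σ => subset_rfl⟩
  | til φ ψ ih₁ ih₂ =>
    obtain ⟨B, hB, h⟩ := ih₁
    obtain ⟨C, hC, h'⟩ := ih₂
    exact ⟨C ∪ (B ∪ {til φ ψ}), hC.union (hB.union (Set.finite_singleton _)), fun σ =>
      Set.union_subset_union (h' σ) (Set.union_subset_union (h σ) subset_rfl)⟩

/-- The true formulas contain exactly one of `x` and `x.compl`, so dualization acts as negation on
this set. -/
theorem sat_dual {π : ℕ → Set AP} {θ : PosBool (LTLFormula AP)} :
    θ.dual.Sat {x | x.Holds π} ↔ ¬ θ.Sat {x | x.Holds π} := by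
  induction θ with
  | tt => simp [PosBool.dual, PosBool.Sat]
  | ff => simp [PosBool.dual, PosBool.Sat]
  | atom x => exact holds_compl
  | and θ χ ih₁ ih₂ =>
    simp only [PosBool.dual, PosBool.Sat, ih₁, ih₂]; tauto
  | or θ χ ih₁ ih₂ =>
    simp only [PosBool.dual, PosBool.Sat, ih₁, ih₂]; tauto

/-- The transition function is correct for the semantics. -/
theorem sat_trans_iff {π : ℕ → Set AP} (ψ : LTLFormula AP) :
    (ψ.trans (π 0)).Sat {x | x.Holds (wordSuffix π 1)} ↔ ψ.Holds π := by
  induction ψ with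
  | tt => simp [trans, PosBool.Sat, Holds]
  | atom p => simp only [trans, Holds]; split_ifs with h <;> simp [PosBool.Sat, h]
  | neg φ ih => rw [trans, sat_dual, ih, Holds]
  | or φ ψ ih₁ ih₂ => exact or_congr ih₁ ih₂
  | next φ ih => rfl
  | til φ ψ ih₁ ih₂ => rw [holds_til]; exact or_congr ih₂ (and_congr ih₁ Iff.rfl)

end LTLFormula

namespace AState

variable {AP : Type*}

theorem rank_ltl_lt_rank_ltl {x y : LTLFormula AP} (h : x.size < y.size) :
    (ltl x).rank < (ltl y).rank := by
  simp [rank, Prod.Lex.toLex_lt_toLex, h]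

theorem rank_ltl_lt_rank_gt (x : LTLFormula AP) (ψ : DFormula AP) (t : ℝ) :
    (ltl x).rank < (gt ψ t).rank := by
  simp [rank, Prod.Lex.toLex_lt_toLex]

theorem rank_gt_lt_rank_gt {φ ψ : DFormula AP} (h : φ.size < ψ.size) (t r : ℝ) :
    (gt φ t).rank < (gt ψ r).rank := by
  simp [rank, Prod.Lex.toLex_lt_toLex, h]

/-- As `0 < t ≤ η 0`, the first index with `η k < t` exists and is nonzero; a shift lowers it. The
ranks of `(ψ > t)` and `(ψ < t)` agree by definition, so this covers both. -/
theorem rank_shift_lt {η : DiscountFun} {φ ψ : DFormula AP} {t : ℝ} (h₀ : 0 < t / η 0)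
    (h₁ : t / η 0 ≤ 1) :
    (gt (.dtil (η.shift 1) φ ψ) t).rank < (gt (.dtil η φ ψ) t).rank := by
  have ht : 0 < t := (div_pos_iff_of_pos_right (η.pos 0)).1 h₀
  have ht' : t ≤ η 0 := (div_le_one (η.pos 0)).1 h₁
  have hne : {k | η k < t}.Nonempty := (η.tendsto_zero.eventually (gt_mem_nhds ht)).exists
  obtain ⟨k, hk⟩ : ∃ k, sInf {k | η k < t} = k + 1 := by
    refine Nat.exists_eq_succ_of_ne_zero fun h => ?_
    have := Nat.sInf_mem hne
    rw [h] at this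
    exact not_lt.2 ht' this
  have hmem : η (k + 1) < t := by
    have := Nat.sInf_mem hne
    rwa [hk] at this
  have : sInf {k | (η.shift 1) k < t} ≤ k := Nat.sInf_le hmem
  simp only [rank, Prod.Lex.toLex_lt_toLex, DFormula.size, DFormula.shiftsBelow, hk]
  exact Or.inr ⟨trivial, Or.inr ⟨trivial, Nat.lt_succ_of_le this⟩⟩

end AState

namespace DFormula

variable {AP : Type*}

theorem rank_lt_of_mem_atoms_trans {σ : Set AP} (ψ : DFormula AP) : ∀ t,
    (∀ s ∈ (ψ.transGt t σ).atoms, s.rank < (AState.gt ψ t).rank ∨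
      s = .gt ψ t ∧ (AState.gt ψ t).IsUntil) ∧
    (∀ s ∈ (ψ.transLt t σ).atoms, s.rank < (AState.gt ψ t).rank ∨
      s = .lt ψ t ∧ (AState.lt ψ t).IsUntil) := by
  -- A self-loop of a subformula is not one for the whole formula: there the size has dropped.
  have of_size : ∀ (φ ψ : DFormula AP) (r t : ℝ) (s : AState AP) (p q : Prop), φ.size < ψ.size →
      (s.rank < (AState.gt φ r).rank ∨ (s = .gt φ r ∧ p)) →
      s.rank < (AState.gt ψ t).rank ∨ q := by
    rintro φ ψ r t s p q h (hs | ⟨rfl, -⟩)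
    · exact Or.inl (hs.trans (AState.rank_gt_lt_rank_gt h _ _))
    · exact Or.inl (AState.rank_gt_lt_rank_gt h _ _)
  have of_size' : ∀ (φ ψ : DFormula AP) (r t : ℝ) (s : AState AP) (p q : Prop), φ.size < ψ.size →
      (s.rank < (AState.gt φ r).rank ∨ (s = .lt φ r ∧ p)) →
      s.rank < (AState.gt ψ t).rank ∨ q := by
    rintro φ ψ r t s p q h (hs | ⟨rfl, -⟩)
    · exact Or.inl (hs.trans (AState.rank_gt_lt_rank_gt h _ _))
    · exact Or.inl (AState.rank_gt_lt_rank_gt h _ _)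
  induction ψ with
  | tt =>
    intro t
    simp only [transGt, transLt]
    split_ifs <;> simp [PosBool.atoms]
  | atom p =>
    intro t
    simp only [transGt, transLt]
    split_ifs <;> simp [PosBool.atoms]
  | neg φ ih =>
    intro t
    have hφ : φ.size < φ.neg.size := Nat.lt_succ_self _
    exact ⟨fun s hs => of_size' _ _ _ _ _ _ _ hφ ((ih (1 - t)).2 s hs),
      fun s hs => of_size _ _ _ _ _ _ _ hφ ((ih (1 - t)).1 s hs)⟩
  | or φ ψ ih₁ ih₂ =>
    intro t
    have hφ : φ.size < (φ.or ψ).size := by simp only [size]; omega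
    have hψ : ψ.size < (φ.or ψ).size := by simp only [size]; omega
    constructor
    · rintro s (hs | hs)
      · exact of_size _ _ _ _ _ _ _ hφ ((ih₁ t).1 s hs)
      · exact of_size _ _ _ _ _ _ _ hψ ((ih₂ t).1 s hs)
    · rintro s (hs | hs)
      · exact of_size' _ _ _ _ _ _ _ hφ ((ih₁ t).2 s hs)
      · exact of_size' _ _ _ _ _ _ _ hψ ((ih₂ t).2 s hs)
  | next φ ih =>
    intro t
    have hφ : φ.size < φ.next.size := Nat.lt_succ_self _
    constructor
    · rintro s rfl
      exact Or.inl (AState.rank_gt_lt_rank_gt hφ _ _)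
    · rintro s rfl
      exact Or.inl (AState.rank_gt_lt_rank_gt hφ _ _)
  | til φ ψ ih₁ ih₂ =>
    intro t
    have hφ : φ.size < (φ.til ψ).size := by simp only [size]; omega
    have hψ : ψ.size < (φ.til ψ).size := by simp only [size]; omega
    simp only [transGt, transLt]
    constructor
    · split_ifs
      · rintro s (hs | hs | hs)
        · exact of_size _ _ _ _ _ _ _ hψ ((ih₂ t).1 s hs)
        · exact of_size _ _ _ _ _ _ _ hφ ((ih₁ t).1 s hs)
        · exact Or.inr ⟨hs, trivial⟩
      · simp [PosBool.atoms]
      · rw [PosBool.atoms_map]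
        rintro _ ⟨x, -, rfl⟩
        exact Or.inl (AState.rank_ltl_lt_rank_gt _ _ _)
    · split_ifs
      · rintro s (hs | hs | hs)
        · exact of_size' _ _ _ _ _ _ _ hψ ((ih₂ t).2 s hs)
        · exact of_size' _ _ _ _ _ _ _ hφ ((ih₁ t).2 s hs)
        · exact Or.inr ⟨hs, trivial⟩
      · simp [PosBool.atoms]
      · simp [PosBool.atoms]
  | dtil η φ ψ ih₁ ih₂ =>
    intro t
    have hφ : φ.size < (dtil η φ ψ).size := by simp only [size]; omega
    have hψ : ψ.size < (dtil η φ ψ).size := by simp only [size]; omega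
    simp only [transGt, transLt]
    constructor
    · split_ifs with h
      · rintro s (hs | hs | rfl)
        · exact of_size _ _ _ _ _ _ _ hψ ((ih₂ _).1 s hs)
        · exact of_size _ _ _ _ _ _ _ hφ ((ih₁ _).1 s hs)
        · exact Or.inl (AState.rank_shift_lt h.1 h.2.le)
      · simp [PosBool.atoms]
      · rw [PosBool.atoms_map]
        rintro _ ⟨x, -, rfl⟩
        exact Or.inl (AState.rank_ltl_lt_rank_gt _ _ _)
    · split_ifs with h
      · rintro s (hs | hs | rfl)
        · exact of_size' _ _ _ _ _ _ _ hψ ((ih₂ _).2 s hs)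
        · exact of_size' _ _ _ _ _ _ _ hφ ((ih₁ _).2 s hs)
        · exact Or.inl (AState.rank_shift_lt h.1 h.2)
      · simp [PosBool.atoms]
      · simp [PosBool.atoms]

theorem exists_finite_atoms_transGt_transLt (ψ : DFormula AP) : ∀ t,
    (∃ B : Set (AState AP), B.Finite ∧ ∀ σ, (ψ.transGt t σ).atoms ⊆ B) ∧
    (∃ B : Set (AState AP), B.Finite ∧ ∀ σ, (ψ.transLt t σ).atoms ⊆ B) := by
  have pos_case : ∀ χ : LTLFormula AP,
      ∃ B : Set (AState AP), B.Finite ∧ ∀ σ, ((χ.trans σ).map AState.ltl).atoms ⊆ B := fun χ => by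
    obtain ⟨B, hB, h⟩ := χ.exists_finite_atoms_trans
    exact ⟨AState.ltl '' B, hB.image _, fun σ => by
      rw [PosBool.atoms_map]; exact Set.image_mono (h σ)⟩
  have empty_case : ∀ (f : Set AP → PosBool (AState AP)), (∀ σ, f σ = .tt ∨ f σ = .ff) →
      ∃ B : Set (AState AP), B.Finite ∧ ∀ σ, (f σ).atoms ⊆ B := fun f hf =>
    ⟨∅, Set.finite_empty, fun σ => by rcases hf σ with h | h <;> simp [h, PosBool.atoms]⟩
  induction ψ with
  | tt =>
    refine fun t => ⟨empty_case _ fun σ => ?_, empty_case _ fun σ => Or.inr rfl⟩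
    simp only [transGt]; split_ifs <;> simp
  | atom p =>
    refine fun t => ⟨empty_case _ fun σ => ?_, empty_case _ fun σ => ?_⟩
    · simp only [transGt]; split_ifs <;> simp
    · simp only [transLt]; split_ifs <;> simp
  | neg φ ih => exact fun t => ⟨(ih _).2, (ih _).1⟩
  | or φ ψ ih₁ ih₂ =>
    intro t
    obtain ⟨⟨B, hB, h⟩, B', hB', h'⟩ := ih₁ t
    obtain ⟨⟨C, hC, k⟩, C', hC', k'⟩ := ih₂ t
    exact ⟨⟨B ∪ C, hB.union hC, fun σ => Set.union_subset_union (h σ) (k σ)⟩,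
      ⟨B' ∪ C', hB'.union hC', fun σ => Set.union_subset_union (h' σ) (k' σ)⟩⟩
  | next φ ih =>
    exact fun t => ⟨⟨{.gt φ t}, Set.finite_singleton _, fun σ => subset_rfl⟩,
      ⟨{.lt φ t}, Set.finite_singleton _, fun σ => subset_rfl⟩⟩
  | til φ ψ ih₁ ih₂ =>
    intro t
    obtain ⟨⟨B, hB, h⟩, B', hB', h'⟩ := ih₁ t
    obtain ⟨⟨C, hC, k⟩, C', hC', k'⟩ := ih₂ t
    simp only [transGt, transLt]
    constructor
    · split_ifs
      · exact ⟨C ∪ (B ∪ {.gt (til φ ψ) t}), hC.union (hB.union (Set.finite_singleton _)), fun σ =>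
          Set.union_subset_union (k σ) (Set.union_subset_union (h σ) subset_rfl)⟩
      · exact empty_case _ fun σ => Or.inr rfl
      · exact pos_case _
    · split_ifs
      · exact ⟨C' ∪ (B' ∪ {.lt (til φ ψ) t}), hC'.union (hB'.union (Set.finite_singleton _)),
          fun σ => Set.union_subset_union (k' σ) (Set.union_subset_union (h' σ) subset_rfl)⟩
      · exact empty_case _ fun σ => Or.inl rfl
      · exact empty_case _ fun σ => Or.inr rfl
  | dtil η φ ψ ih₁ ih₂ =>
    intro t
    obtain ⟨⟨B, hB, h⟩, B', hB', h'⟩ := ih₁ (t / η 0)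
    obtain ⟨⟨C, hC, k⟩, C', hC', k'⟩ := ih₂ (t / η 0)
    simp only [transGt, transLt]
    constructor
    · split_ifs
      · exact ⟨C ∪ (B ∪ {.gt (dtil (η.shift 1) φ ψ) t}),
          hC.union (hB.union (Set.finite_singleton _)), fun σ =>
          Set.union_subset_union (k σ) (Set.union_subset_union (h σ) subset_rfl)⟩
      · exact empty_case _ fun σ => Or.inr rfl
      · exact pos_case _
    · split_ifs
      · exact ⟨C' ∪ (B' ∪ {.lt (dtil (η.shift 1) φ ψ) t}),
          hC'.union (hB'.union (Set.finite_singleton _)), fun σ =>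
          Set.union_subset_union (k' σ) (Set.union_subset_union (h' σ) subset_rfl)⟩
      · exact empty_case _ fun σ => Or.inl rfl
      · exact empty_case _ fun σ => Or.inr rfl

end DFormula

namespace AState

variable {AP : Type*}

theorem rank_lt_of_mem_atoms_trans {s s' : AState AP} {σ : Set AP}
    (h : s' ∈ (s.trans σ).atoms) : s'.rank < s.rank ∨ s' = s ∧ s.IsUntil := by
  cases s with
  | gt ψ t => exact (ψ.rank_lt_of_mem_atoms_trans t).1 s' h
  | lt ψ t => exact (ψ.rank_lt_of_mem_atoms_trans t).2 s' h
  | ltl ψ =>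
    rw [trans, PosBool.atoms_map] at h
    obtain ⟨x, hx, rfl⟩ := h
    rcases ψ.size_lt_of_mem_atoms_trans x hx with h | ⟨rfl, h⟩
    · exact Or.inl (rank_ltl_lt_rank_ltl h)
    · exact Or.inr ⟨rfl, h⟩

theorem exists_finite_atoms_trans (s : AState AP) :
    ∃ B : Set (AState AP), B.Finite ∧ ∀ σ, (s.trans σ).atoms ⊆ B := by
  cases s with
  | gt ψ t => exact (ψ.exists_finite_atoms_transGt_transLt t).1
  | lt ψ t => exact (ψ.exists_finite_atoms_transGt_transLt t).2
  | ltl ψ =>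
    obtain ⟨B, hB, h⟩ := ψ.exists_finite_atoms_trans
    exact ⟨ltl '' B, hB.image _, fun σ => by
      rw [trans, PosBool.atoms_map]; exact Set.image_mono (h σ)⟩

/-- By induction on the rank: apart from `s`, everything reachable is reachable from one of finitely
many successors of smaller rank. -/
theorem finite_setOf_reachable (s : AState AP) : {s' | s.Reachable s'}.Finite := by
  induction s using (InvImage.wf (rank (AP := AP)) wellFounded_lt).induction with
  | _ s ih =>
    obtain ⟨B, hB, h⟩ := s.exists_finite_atoms_trans
    refine ((Set.finite_singleton s).union ((hB.subset (Set.sep_subset B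
      fun x => x.rank < s.rank)).biUnion fun x hx => ih x hx.2)).subset ?_
    intro s' hs'
    induction hs' with
    | init => exact Or.inl rfl
    | step σ _ hmem ih' =>
      rcases ih' with rfl | ih'
      · rcases rank_lt_of_mem_atoms_trans hmem with hlt | ⟨rfl, -⟩
        · exact Or.inr (Set.mem_biUnion ⟨h σ hmem, hlt⟩ Reachable.init)
        · exact Or.inl rfl
      · obtain ⟨x, hx, hx'⟩ := Set.mem_iUnion₂.1 ih'
        exact Or.inr (Set.mem_biUnion hx (Reachable.step σ hx' hmem))

end AState
/-! ## Semantics of states -/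

namespace AState

variable {AP : Type*}

/-- The assertion that a state makes about the remaining computation. -/
def Holds : AState AP → (ℕ → Set AP) → Prop
  | gt ψ t, π => t < ψ.value π
  | lt ψ t, π => ψ.value π < t
  | ltl ψ, π => ψ.Holds π

/-- The threshold of an assertion lies in `[0, 1]`. -/
def Valid : AState AP → Prop
  | gt _ t => t ∈ Set.Icc (0 : ℝ) 1
  | lt _ t => t ∈ Set.Icc (0 : ℝ) 1
  | ltl _ => True

end AState

namespace DFormula

variable {AP : Type*}

theorem valid_of_mem_atoms_trans {σ : Set AP} (ψ : DFormula AP) : ∀ t ∈ Set.Icc (0 : ℝ) 1,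
    (∀ s ∈ (ψ.transGt t σ).atoms, s.Valid) ∧ (∀ s ∈ (ψ.transLt t σ).atoms, s.Valid) := by
  induction ψ with
  | tt => intro t _; simp only [transGt, transLt]; split_ifs <;> simp [PosBool.atoms]
  | atom p => intro t _; simp only [transGt, transLt]; split_ifs <;> simp [PosBool.atoms]
  | neg φ ih =>
    intro t ht
    have := ih (1 - t) ⟨sub_nonneg.2 ht.2, sub_le_self _ ht.1⟩
    exact ⟨this.2, this.1⟩
  | or φ ψ ih₁ ih₂ =>
    intro t ht
    exact ⟨fun s hs => hs.elim ((ih₁ t ht).1 s) ((ih₂ t ht).1 s),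
      fun s hs => hs.elim ((ih₁ t ht).2 s) ((ih₂ t ht).2 s)⟩
  | next φ ih =>
    intro t ht
    constructor <;> (rintro s rfl; exact ht)
  | til φ ψ ih₁ ih₂ =>
    intro t ht
    simp only [transGt, transLt]
    constructor
    · split_ifs
      · rintro s (hs | hs | rfl)
        · exact (ih₂ t ht).1 s hs
        · exact (ih₁ t ht).1 s hs
        · exact ht
      · simp [PosBool.atoms]
      · rw [PosBool.atoms_map]
        rintro _ ⟨x, -, rfl⟩
        trivial
    · split_ifs
      · rintro s (hs | hs | rfl)
        · exact (ih₂ t ht).2 s hs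
        · exact (ih₁ t ht).2 s hs
        · exact ht
      · simp [PosBool.atoms]
      · simp [PosBool.atoms]
  | dtil η φ ψ ih₁ ih₂ =>
    intro t ht
    simp only [transGt, transLt]
    constructor
    · split_ifs with h
      · have h' : t / η 0 ∈ Set.Icc (0 : ℝ) 1 := ⟨h.1.le, h.2.le⟩
        rintro s (hs | hs | rfl)
        · exact (ih₂ _ h').1 s hs
        · exact (ih₁ _ h').1 s hs
        · exact ht
      · simp [PosBool.atoms]
      · rw [PosBool.atoms_map]
        rintro _ ⟨x, -, rfl⟩
        trivial
    · split_ifs with h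
      · have h' : t / η 0 ∈ Set.Icc (0 : ℝ) 1 := ⟨h.1.le, h.2⟩
        rintro s (hs | hs | rfl)
        · exact (ih₂ _ h').2 s hs
        · exact (ih₁ _ h').2 s hs
        · exact ht
      · simp [PosBool.atoms]
      · simp [PosBool.atoms]

/-- The transition function is sound and complete for the semantics. For soundness, the word has to
have finitely many suffixes, because of the formulas `φ⁺`. -/
theorem sat_trans_iff {π : ℕ → Set AP} (ψ : DFormula AP) : ∀ t ∈ Set.Icc (0 : ℝ) 1,
    ((t < ψ.value π → (ψ.transGt t (π 0)).Sat {s | s.Holds (wordSuffix π 1)}) ∧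
      (FinitelyManySuffixes π →
        (ψ.transGt t (π 0)).Sat {s | s.Holds (wordSuffix π 1)} → t < ψ.value π)) ∧
    ((ψ.value π < t → (ψ.transLt t (π 0)).Sat {s | s.Holds (wordSuffix π 1)}) ∧
      (FinitelyManySuffixes π →
        (ψ.transLt t (π 0)).Sat {s | s.Holds (wordSuffix π 1)} → ψ.value π < t)) := by
  have hpos : ∀ χ : LTLFormula AP,
      ((χ.trans (π 0)).map AState.ltl).Sat {s | s.Holds (wordSuffix π 1)} ↔ χ.Holds π := fun χ => by
    rw [PosBool.sat_map, ← LTLFormula.sat_trans_iff]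
    rfl
  induction ψ with
  | tt =>
    intro t ht
    simp only [transGt, transLt, value]
    split_ifs <;> simp_all [PosBool.Sat]
  | atom p =>
    intro t ht
    simp only [transGt, transLt, value]
    have h₁ := ht.1
    have h₂ := ht.2
    by_cases hp : p ∈ π 0
    · by_cases h : t < 1 <;> simp [hp, h, PosBool.Sat, h₂]
    · by_cases h : t = 0
      · simp [hp, h, PosBool.Sat]
      · simp [hp, h, PosBool.Sat, h₁, lt_of_le_of_ne h₁ (Ne.symm h)]
  | neg φ ih =>
    intro t ht
    have := ih (1 - t) ⟨sub_nonneg.2 ht.2, sub_le_self _ ht.1⟩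
    simp only [transGt, transLt, value]
    exact ⟨⟨fun h => this.2.1 (by linarith), fun hf h => by linarith [this.2.2 hf h]⟩,
      ⟨fun h => this.1.1 (by linarith), fun hf h => by linarith [this.1.2 hf h]⟩⟩
  | or φ ψ ih₁ ih₂ =>
    intro t ht
    have h₁ := ih₁ t ht
    have h₂ := ih₂ t ht
    simp only [transGt, transLt, value, lt_max_iff, max_lt_iff, PosBool.Sat]
    exact ⟨⟨Or.imp h₁.1.1 h₂.1.1, fun hf => Or.imp (h₁.1.2 hf) (h₂.1.2 hf)⟩,
      ⟨And.imp h₁.2.1 h₂.2.1, fun hf => And.imp (h₁.2.2 hf) (h₂.2.2 hf)⟩⟩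
  | next φ ih => exact fun t ht => ⟨⟨id, fun _ => id⟩, ⟨id, fun _ => id⟩⟩
  | til φ ψ ih₁ ih₂ =>
    intro t ht
    have h₁ := ih₁ t ht
    have h₂ := ih₂ t ht
    have hv := value_mem_Icc (til φ ψ) π
    simp only [transGt, transLt]
    constructor
    · split_ifs with h h'
      · rw [value_til, lt_max_iff, lt_min_iff]
        exact ⟨Or.imp h₂.1.1 (And.imp h₁.1.1 id),
          fun hf => Or.imp (h₂.1.2 hf) (And.imp (h₁.1.2 hf) id)⟩
      · exact ⟨fun hlt => absurd (hlt.trans_le hv.2) (not_lt.2 h'), fun _ => False.elim⟩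
      · obtain rfl : t = 0 := by
          refine le_antisymm (not_lt.1 fun h₀ => h ⟨h₀, not_le.1 h'⟩) ht.1
        rw [hpos]
        exact ⟨(holds_pos_and_holds_ltOne _ _).1,
          fun hf => (value_of_holds_pos_and_ltOne _ _ hf).1⟩
    · split_ifs with h h'
      · rw [value_til, max_lt_iff, min_lt_iff]
        exact ⟨And.imp h₂.2.1 (Or.imp h₁.2.1 id),
          fun hf => And.imp (h₂.2.2 hf) (Or.imp (h₁.2.2 hf) id)⟩
      · exact absurd ht.2 (not_le.2 h')
      · obtain rfl : t = 0 := le_antisymm (not_lt.1 fun h₀ => h ⟨h₀, ht.2⟩) ht.1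
        exact ⟨fun hlt => absurd hv.1 (not_le.2 hlt), fun _ => False.elim⟩
  | dtil η φ ψ ih₁ ih₂ =>
    intro t ht
    have hη := η.pos 0
    have hv := value_mem_Icc (dtil η φ ψ) π
    have hv' := value_dtil_le η φ ψ π
    have hr : 0 ≤ t / η 0 := div_nonneg ht.1 hη.le
    have hzero : ¬ 0 < t / η 0 → t = 0 := fun h => by
      have := le_antisymm (not_lt.1 h) hr
      simpa [hη.ne'] using this
    simp only [transGt, transLt]
    constructor
    · split_ifs with h h'
      · have h₁ := ih₁ _ ⟨hr, h.2.le⟩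
        have h₂ := ih₂ _ ⟨hr, h.2.le⟩
        -- Division by `η 0 > 0` yields the threshold `t / η 0` for `φ` and `ψ`; the shifted until
        -- is untouched.
        rw [value_dtil, lt_max_iff, lt_min_iff, ← div_lt_iff₀' hη, ← div_lt_iff₀' hη]
        exact ⟨Or.imp h₂.1.1 (And.imp h₁.1.1 id),
          fun hf => Or.imp (h₂.1.2 hf) (And.imp (h₁.1.2 hf) id)⟩
      · rw [one_le_div hη] at h'
        exact ⟨fun hlt => absurd (hlt.trans_le hv') (not_lt.2 h'), fun _ => False.elim⟩
      · obtain rfl : t = 0 := hzero fun h₀ => h ⟨h₀, not_le.1 h'⟩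
        rw [hpos]
        exact ⟨(holds_pos_and_holds_ltOne _ _).1,
          fun hf => (value_of_holds_pos_and_ltOne _ _ hf).1⟩
    · split_ifs with h h'
      · have h₁ := ih₁ _ ⟨hr, h.2⟩
        have h₂ := ih₂ _ ⟨hr, h.2⟩
        rw [value_dtil, max_lt_iff, min_lt_iff, ← lt_div_iff₀' hη, ← lt_div_iff₀' hη]
        exact ⟨And.imp h₂.2.1 (Or.imp h₁.2.1 id),
          fun hf => And.imp (h₂.2.2 hf) (Or.imp (h₁.2.2 hf) id)⟩
      · rw [one_lt_div hη] at h'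
        exact ⟨fun _ => trivial, fun _ _ => hv'.trans_lt h'⟩
      · obtain rfl : t = 0 := hzero fun h₀ => h ⟨h₀, not_lt.1 h'⟩
        exact ⟨fun hlt => absurd hv.1 (not_le.2 hlt), fun _ => False.elim⟩

end DFormula

namespace AState

variable {AP : Type*}

theorem Valid.of_mem_atoms_trans {s s' : AState AP} {σ : Set AP} (hs : s.Valid)
    (h : s' ∈ (s.trans σ).atoms) : s'.Valid := by
  cases s with
  | gt ψ t => exact (ψ.valid_of_mem_atoms_trans t hs).1 s' h
  | lt ψ t => exact (ψ.valid_of_mem_atoms_trans t hs).2 s' h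
  | ltl ψ =>
    rw [trans, PosBool.atoms_map] at h
    obtain ⟨x, -, rfl⟩ := h
    trivial

theorem Reachable.valid {s s' : AState AP} (h : s.Reachable s') (hs : s.Valid) : s'.Valid := by
  induction h with
  | init => exact hs
  | step σ _ hmem ih => exact ih.of_mem_atoms_trans hmem

theorem sat_trans_of_holds {s : AState AP} (hs : s.Valid) {π : ℕ → Set AP} {l : ℕ}
    (h : s.Holds (wordSuffix π l)) :
    (s.trans (π l)).Sat {s | s.Holds (wordSuffix π (l + 1))} := by
  rw [← wordSuffix_wordSuffix]
  change (s.trans (wordSuffix π l 0)).Sat _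
  cases s with
  | gt ψ t => exact (ψ.sat_trans_iff t hs).1.1 h
  | lt ψ t => exact (ψ.sat_trans_iff t hs).2.1 h
  | ltl ψ => rw [trans, PosBool.sat_map]; exact ψ.sat_trans_iff.2 h

theorem holds_of_sat_trans {s : AState AP} (hs : s.Valid) {π : ℕ → Set AP}
    (hπ : FinitelyManySuffixes π) {l : ℕ}
    (h : (s.trans (π l)).Sat {s | s.Holds (wordSuffix π (l + 1))}) :
    s.Holds (wordSuffix π l) := by
  rw [← wordSuffix_wordSuffix] at h
  change (s.trans (wordSuffix π l 0)).Sat _ at h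
  cases s with
  | gt ψ t => exact (ψ.sat_trans_iff t hs).1.2 (hπ.suffix l) h
  | lt ψ t => exact (ψ.sat_trans_iff t hs).2.2 (hπ.suffix l) h
  | ltl ψ => rw [trans, PosBool.sat_map] at h; exact ψ.sat_trans_iff.1 h

/-- A rejecting state that holds need not stay in place forever. -/
theorem exists_sat_trans_diff {s : AState AP} (hs : s.Valid) (hacc : ¬ s.IsAcc) {π : ℕ → Set AP}
    {l : ℕ} (h : ∀ i, s.Holds (wordSuffix π (l + i))) :
    ∃ i, (s.trans (π (l + i))).Sat ({s' | s'.Holds (wordSuffix π (l + i + 1))} \ {s}) := by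
  by_cases hmem : s ∈ (s.trans (π l)).atoms
  · rcases rank_lt_of_mem_atoms_trans hmem with hlt | ⟨-, huntil⟩
    · exact absurd hlt (lt_irrefl _)
    match s, hs, hacc, h, hmem, huntil with
    | gt (.til φ ψ) t, hs, _, h, hmem, _ =>
      obtain ⟨i, hi, -⟩ := DFormula.lt_value_til_iff.1 (h 0)
      rw [add_zero, wordSuffix_wordSuffix] at hi
      -- Outside this range the transition is `False` or consists of LTL states, so there is no
      -- self-loop.
      have hc : 0 < t ∧ t < 1 := by
        by_contra hc
        simp only [trans, DFormula.transGt, if_neg hc] at hmem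
        split_ifs at hmem
        · exact hmem
        · rw [PosBool.atoms_map] at hmem
          obtain ⟨x, -, hx⟩ := hmem
          cases hx
      refine ⟨i, ?_⟩
      simp only [trans, DFormula.transGt, if_pos hc]
      -- At the witness `i` the until is discharged through `ψ`, whose transitions only mention
      -- states of rank below that of the until.
      refine Or.inl ((sat_trans_of_holds (s := gt ψ t) hs hi).mono fun x hx hx' => ⟨hx', ?_⟩)
      rintro rfl
      have hle : (gt (.til φ ψ) t).rank ≤ (gt ψ t).rank :=
        (rank_lt_of_mem_atoms_trans (s := gt ψ t) hx).elim le_of_lt fun h => h.1 ▸ le_rfl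
      refine absurd hle (not_le.2 (rank_gt_lt_rank_gt ?_ _ _))
      simp only [DFormula.size]; omega
    | ltl (.til a b), _, _, h, _, _ =>
      obtain ⟨i, hi, -⟩ := h 0
      rw [add_zero, wordSuffix_wordSuffix] at hi
      refine ⟨i, Or.inl ((sat_trans_of_holds (s := ltl b) trivial hi).mono
        fun x hx hx' => ⟨hx', ?_⟩)⟩
      rintro rfl
      have hle : (ltl (.til a b)).rank ≤ (ltl b).rank :=
        (rank_lt_of_mem_atoms_trans (s := ltl b) hx).elim le_of_lt fun h => h.1 ▸ le_rfl
      refine absurd hle (not_le.2 (rank_ltl_lt_rank_ltl ?_))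
      simp only [LTLFormula.size]; omega
    | lt (.til _ _) _, _, hacc, _, _, _ => exact absurd trivial hacc
    | ltl (.neg (.til _ _)), _, hacc, _, _, _ => exact absurd trivial hacc
  · refine ⟨0, (sat_trans_of_holds hs (h 0)).mono fun x hx hx' => ⟨hx', ?_⟩⟩
    rintro rfl
    exact hmem hx

/-- Soundness: in an accepting dag on a word with finitely many suffixes, all states hold. -/
theorem holds_of_dag {π : ℕ → Set AP} (hπ : FinitelyManySuffixes π) {V : ℕ → Set (AState AP)}
    {E : ℕ → AState AP → AState AP → Prop} (hvalid : ∀ l, ∀ s ∈ V l, s.Valid)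
    (hE : ∀ l s s', E l s s' → s' ∈ V (l + 1))
    (hsat : ∀ l, ∀ s ∈ V l, (s.trans (π l)).Sat {s' | E l s s'})
    (hacc : ∀ l s, ¬ s.IsAcc → ∃ i, ¬ E (l + i) s s) (s : AState AP) :
    ∀ l, s ∈ V l → s.Holds (wordSuffix π l) := by
  induction s using (InvImage.wf (rank (AP := AP)) wellFounded_lt).induction with
  | _ s ih =>
  have ih : ∀ s' : AState AP, s'.rank < s.rank → ∀ l, s' ∈ V l → s'.Holds (wordSuffix π l) := ih
  -- By induction on the rank all successors other than `s` hold, so only the self-loop remains to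
  -- be treated.
  have hstep : ∀ l, s ∈ V l → (E l s s → s.Holds (wordSuffix π (l + 1))) →
      s.Holds (wordSuffix π l) := by
    intro l hl hself
    refine holds_of_sat_trans (hvalid l s hl) hπ ((hsat l s hl).mono fun x hx hx' => ?_)
    rcases rank_lt_of_mem_atoms_trans hx with hlt | ⟨rfl, -⟩
    · exact ih x hlt _ (hE _ _ _ hx')
    · exact hself hx'
  -- `δ` of an until embeds `δ` of its arguments, which need not be nodes of the dag. If the
  -- successors of `s` satisfy `δ(s')`, then `s'` still holds.
  have hlower : ∀ s' : AState AP, s'.rank < s.rank → s'.Valid → ∀ l,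
      (s'.trans (π l)).Sat {x | E l s x} → s'.Holds (wordSuffix π l) := by
    intro s' hlt hs' l h
    refine holds_of_sat_trans hs' hπ (h.mono fun x hx hx' => ?_)
    refine ih x (lt_of_le_of_lt ?_ hlt) _ (hE _ _ _ hx')
    exact (rank_lt_of_mem_atoms_trans hx).elim le_of_lt fun h => h.1 ▸ le_rfl
  by_cases hs : s.IsAcc
  · intro l hl
    match s, hs with
    | lt (.til φ ψ) t, _ =>
      have ht := hvalid l _ hl
      have hφ : φ.size < (φ.til ψ).size := by simp only [DFormula.size]; omega
      have hψ : ψ.size < (φ.til ψ).size := by simp only [DFormula.size]; omega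
      by_cases hc : 0 < t ∧ t ≤ 1
      -- While the dag stays in the self-loop it enforces `ψ < t` at each level, so it must have
      -- left, through `φ < t`, before a position where `t ≤ ψ`.
      · have key : ∀ i l, lt (.til φ ψ) t ∈ V l → t ≤ ψ.value (wordSuffix π (l + i)) →
            ∃ j < i, φ.value (wordSuffix π (l + j)) < t := by
          intro i
          induction i with
          | zero =>
            intro l hl hle
            have := hsat l _ hl
            simp only [trans, DFormula.transLt, if_pos hc] at this
            exact absurd (hlower (lt ψ t) (rank_gt_lt_rank_gt hψ _ _) ht l this.1) (not_lt.2 hle)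
          | succ i ihi =>
            intro l hl hle
            have := hsat l _ hl
            simp only [trans, DFormula.transLt, if_pos hc] at this
            rcases this.2 with h | h
            · exact ⟨0, Nat.succ_pos i, hlower (lt φ t) (rank_gt_lt_rank_gt hφ _ _) ht l h⟩
            · obtain ⟨j, hj, h'⟩ := ihi (l + 1) (hE _ _ _ h) (by
                rwa [add_assoc, add_comm 1 i])
              exact ⟨j + 1, Nat.succ_lt_succ hj, by rwa [add_assoc, add_comm 1 j] at h'⟩
        refine not_le.1 fun hle => ?_
        -- Periodicity is used here: a value `≥ t` is reached at one position `i`, which `key`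
        -- excludes.
        obtain ⟨i, h₁, h₂⟩ := (DFormula.le_value_til_iff (hπ.suffix l)).1 hle
        simp only [wordSuffix_wordSuffix] at h₁ h₂
        obtain ⟨j, hj, h⟩ := key i l hl h₁
        exact not_le.2 h (h₂ j hj)
      · have := hsat l _ hl
        simp only [trans, DFormula.transLt, if_neg hc, if_neg (not_lt.2 ht.2)] at this
        exact this.elim
    | ltl (.neg (.til a b)), _ =>
      have ha : (LTLFormula.neg a).size < (LTLFormula.neg (a.til b)).size := by
        have := b.size_pos
        simp only [LTLFormula.size]; omega
      have hb : (LTLFormula.neg b).size < (LTLFormula.neg (a.til b)).size := by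
        have := a.size_pos
        simp only [LTLFormula.size]; omega
      have key : ∀ i l, ltl (.neg (.til a b)) ∈ V l → b.Holds (wordSuffix π (l + i)) →
          ∃ j < i, ¬ a.Holds (wordSuffix π (l + j)) := by
        intro i
        induction i with
        | zero =>
          intro l hl h
          exact absurd h
            (hlower (ltl b.neg) (rank_ltl_lt_rank_ltl hb) trivial l (hsat l _ hl).1)
        | succ i ihi =>
          intro l hl hi
          rcases (hsat l _ hl).2 with h | h
          · exact ⟨0, Nat.succ_pos i,
              hlower (ltl a.neg) (rank_ltl_lt_rank_ltl ha) trivial l h⟩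
          · obtain ⟨j, hj, h'⟩ := ihi (l + 1) (hE _ _ _ h) (by
              rwa [add_assoc, add_comm 1 i])
            exact ⟨j + 1, Nat.succ_lt_succ hj, by rwa [add_assoc, add_comm 1 j] at h'⟩
      rintro ⟨i, h₁, h₂⟩
      simp only [wordSuffix_wordSuffix] at h₁ h₂
      obtain ⟨j, hj, h⟩ := key i l hl h₁
      exact h (h₂ j hj)
  -- A rejecting state cannot loop forever; truth is carried back to `l` from the level where the
  -- self-loop is missing.
  · have key : ∀ i l, s ∈ V l → ¬ E (l + i) s s → s.Holds (wordSuffix π l) := by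
      intro i
      induction i with
      | zero => exact fun l hl h => hstep l hl fun h' => absurd h' h
      | succ i ihi =>
        refine fun l hl h => hstep l hl fun h' => ihi (l + 1) (hE _ _ _ h') ?_
        rwa [add_assoc, add_comm 1 i]
    intro l hl
    obtain ⟨i, hi⟩ := hacc l s hs
    exact key i l hl hi

end AState

/-! ## The automaton of a discounted formula -/

section DiscAutomaton

variable {AP : Type*} {φ : DFormula AP} {v : ℝ}

instance finite_reachable (s : AState AP) : Finite {s' : AState AP // s.Reachable s'} :=
  s.finite_setOf_reachable.to_subtype

theorem eq_or_rank_lt_of_mem_atoms_discAutomaton (φ : DFormula AP) (v : ℝ)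
    (q : {s : AState AP // (AState.gt φ v).Reachable s}) (σ : Set AP) :
    ∀ s ∈ ((discAutomaton φ v).δ q σ).atoms, s = q ∨ s.1.rank < q.1.rank := fun s hs =>
  (AState.rank_lt_of_mem_atoms_trans ((PosBool.mem_atoms_restrict _).1 hs)).symm.imp_left
    fun h => Subtype.ext h.1

theorem isAWA_discAutomaton (φ : DFormula AP) (v : ℝ) : (discAutomaton φ v).IsAWA :=
  ⟨inferInstance, AltAutomaton.isWeak_of_rank _ (fun q => q.1.rank)
    (eq_or_rank_lt_of_mem_atoms_discAutomaton φ v)⟩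

/-- The automaton accepts all computations whose value exceeds the threshold. -/
theorem accepts_discAutomaton_of_lt_value (hv : v ∈ Set.Icc (0 : ℝ) 1) {π : ℕ → Set AP}
    (h : v < φ.value π) : (discAutomaton φ v).Accepts π := by
  refine AltAutomaton.accepts_of_invariant _ π (fun l => {q | q.1.Holds (wordSuffix π l)})
    (fun q => q.1.rank) (by simpa [discAutomaton, AState.Holds] using h) ?_
    (eq_or_rank_lt_of_mem_atoms_discAutomaton φ v) ?_
  · intro l q hq
    refine (PosBool.sat_restrict _).2 ((AState.sat_trans_of_holds (q.2.valid hv) hq).mono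
      fun x hx hx' => ⟨⟨x, q.2.step _ hx⟩, hx', rfl⟩)
  · intro l q hacc hq
    obtain ⟨i, hi⟩ := AState.exists_sat_trans_diff (q.2.valid hv) hacc hq
    refine ⟨i, (PosBool.sat_restrict _).2 (hi.mono fun x hx hx' => ?_)⟩
    exact ⟨⟨x, q.2.step _ hx⟩, ⟨hx'.1, fun h => hx'.2 (congrArg Subtype.val h)⟩, rfl⟩

/-- On words with finitely many suffixes, acceptance implies that the value exceeds the
threshold. -/
theorem lt_value_of_accepts_discAutomaton (hv : v ∈ Set.Icc (0 : ℝ) 1) {π : ℕ → Set AP}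
    (hπ : FinitelyManySuffixes π) (h : (discAutomaton φ v).Accepts π) : v < φ.value π := by
  obtain ⟨V, E, hrun, hacc⟩ := h
  have := AState.holds_of_dag hπ (V := fun l => Subtype.val '' V l)
    (E := fun l s s' => ∃ q q', E l q q' ∧ q.1 = s ∧ q'.1 = s') ?_ ?_ ?_ ?_ (.gt φ v) 0
    ⟨(discAutomaton φ v).init, by rw [hrun.root]; rfl, rfl⟩
  · simpa [AState.Holds] using this
  · rintro l _ ⟨q, -, rfl⟩
    exact q.2.valid hv
  · rintro l _ _ ⟨q, q', hE, rfl, rfl⟩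
    exact ⟨q', (hrun.edge_mem l q q' hE).2, rfl⟩
  · rintro l _ ⟨q, hq, rfl⟩
    refine ((PosBool.sat_restrict _).1 (hrun.sat l q hq)).mono ?_
    rintro _ - ⟨q', hq', rfl⟩
    exact ⟨q, q', hq', rfl, rfl⟩
  · intro l s hs
    -- Self-loops at all levels from `l` on would form an infinite path that stays in one rejecting
    -- state.
    by_contra! hcon
    obtain ⟨q, -, -, rfl, -⟩ := hcon 0
    obtain ⟨i, -, hi⟩ := hacc l (fun _ => q) (fun i => by
      obtain ⟨q₁, q₂, hE, h₁, h₂⟩ := hcon i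
      rwa [Subtype.ext h₁, Subtype.ext h₂] at hE) 0
    exact hs hi

end DiscAutomaton

theorem mainTheorem9 {AP : Type*} (D : Set DiscountFun) (φ : DFormula AP) (hφ : φ.Over D)
    (v : ℝ) (hv : v ∈ Set.Icc (0 : ℝ) 1) :
    (discAutomaton φ v).IsAWA ∧
      ((discAutomaton φ v).language.Nonempty ↔ ∃ π : ℕ → Set AP, v < φ.value π) := by
  refine ⟨isAWA_discAutomaton φ v, ?_, ?_⟩
  · rintro ⟨w, hw⟩
    -- The accepted word `w` itself may have value at most `v`; the witness is an accepted word with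
    -- finitely many suffixes.
    obtain ⟨π, hacc, hπ⟩ := AltAutomaton.Accepts.exists_lasso hw
    exact ⟨π, lt_value_of_accepts_discAutomaton hv hπ hacc⟩
  · rintro ⟨π, hπ⟩
    exact ⟨π, accepts_discAutomaton_of_lt_value hv hπ⟩
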